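/- For $\lambda\in\mathbb C$ with $|\lambda|>1$ let $S_\lambda$ be the Hopf surface, i.e. the quotient of $\mathbb C^2\setminus\{0\}$ by the $\mathbb Z$-action $n\cdot(x,y)=(\lambda^n x,\lambda^n y)$. For a holomorphic map $f:\mathbb C^2\to X$ into a compact complex surface $X$ and a smooth hermitian metric on $X$ with metric form $\omega$, put $$T_f(r;\omega)=\int_1^r\frac{dt}{t^{3}}\int_{\{\|z\|<t\}} f^*\omega\wedge\alpha,\qquad \alpha=dd^c\|z\|^2,\quad d^c=\tfrac{i}{4\pi}(\bar\partial-\partial),$$ $$\rho_f=\limsup_{r\to\infty}\frac{\log T_f(r;\omega)}{\log r}.$$ The map $f$ is called differentiably non-degenerate if $df$ has rank $2$ on a dense open subset of $\mathbb C^2$. Theorem. For every $\lambda\in\mathbb C$ with $|\lambda|>1$, $S_\lambda$ is a compact connected complex surface that carries hermitian metrics but no Kähler metric, and there is a differentiably non-degenerate holomorphic map $f:\mathbb C^2\to S_\lambda$ such that $\rho_f=1$ for every choice of the hermitian metric on $S_\lambda$. -/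

import Mathlib

open scoped Manifold ContDiff

noncomputable section

/-- `ℂ²` with its Euclidean norm. -/
abbrev C2 : Type := EuclideanSpace ℂ (Fin 2)

/-- Multiplication by `i` on `ℂ²`, as a real-linear map. -/
def mulI : C2 →L[ℝ] C2 := Complex.I • ContinuousLinearMap.id ℝ C2

/-! ### Hermitian metrics on complex surfaces -/

section ComplexSurface

variable {X : Type*} [TopologicalSpace X] [ChartedSpace C2 X]

/-- The complex structure on the real tangent space of a complex surface. The tangent space at `x`
is modelled on `ℂ²` through the chart at `x`; as the transition maps are holomorphic, multiplication
by `i` in that chart is the complex structure. -/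
def tangentJ (x : X) : TangentSpace 𝓘(ℝ, C2) x →L[ℝ] TangentSpace 𝓘(ℝ, C2) x := mulI

lemma tangentJ_tangentJ (x : X) (v : TangentSpace 𝓘(ℝ, C2) x) :
    tangentJ x (tangentJ x v) = -v := by
  change Complex.I • (Complex.I • (show C2 from v)) = -(show C2 from v)
  rw [smul_smul, Complex.I_mul_I, neg_one_smul]

variable (X) in
/-- A smooth hermitian metric on a complex surface, given by its real part: a smooth Riemannian
metric that is invariant under the complex structure. -/
structure HermitianMetric [IsManifold 𝓘(ℝ, C2) ∞ X] extends
    Bundle.ContMDiffRiemannianMetric 𝓘(ℝ, C2) ∞ C2 (fun x : X ↦ TangentSpace 𝓘(ℝ, C2) x) where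
  inner_J (x : X) (u v : TangentSpace 𝓘(ℝ, C2) x) :
    inner x (tangentJ x u) (tangentJ x v) = inner x u v

/-- The metric form `ω(u, v) = g(Ju, v)` of a hermitian metric, a positive `(1,1)`-form. -/
def HermitianMetric.form [IsManifold 𝓘(ℝ, C2) ∞ X] (g : HermitianMetric X) (x : X) :
    TangentSpace 𝓘(ℝ, C2) x [⋀^Fin 2]→L[ℝ] ℝ where
  toFun v := g.inner x (tangentJ x (v 0)) (v 1)
  map_update_add' := by
    intro _ m i a b
    fin_cases i <;> simp [Function.update]
  map_update_smul' := by
    intro _ m i c a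
    fin_cases i <;> simp [Function.update]
  cont := by
    let b : C2 →L[ℝ] C2 →L[ℝ] ℝ := (g.inner x).comp (tangentJ x)
    change Continuous fun v : Fin 2 → C2 ↦ b (v 0) (v 1)
    fun_prop
  map_eq_zero_of_eq' := by
    have key : ∀ u : TangentSpace 𝓘(ℝ, C2) x, g.inner x (tangentJ x u) u = 0 := by
      intro u
      have h := g.inner_J x (tangentJ x u) u
      rw [tangentJ_tangentJ, map_neg, neg_apply, g.symm x u] at h
      linarith
    intro v i j hv hij
    fin_cases i <;> fin_cases j <;> simp_all

/-- The pull-back `φ^* η` of a 2-form on `X` by a map `φ : ℂ² → X`. -/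
def pullbackForm (η : ∀ x : X, TangentSpace 𝓘(ℝ, C2) x [⋀^Fin 2]→L[ℝ] ℝ) (φ : C2 → X) (z : C2) :
    C2 [⋀^Fin 2]→L[ℝ] ℝ :=
  (η (φ z)).compContinuousLinearMap (mfderiv 𝓘(ℝ, C2) 𝓘(ℝ, C2) φ z)

variable (X) in
/-- `X` is Kähler: it carries a hermitian metric whose form is closed, `dω = 0` in every chart. -/
def IsKahler [IsManifold 𝓘(ℝ, C2) ∞ X] : Prop :=
  ∃ g : HermitianMetric X, ∀ e ∈ atlas C2 X, ∀ y ∈ e.target,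
    extDeriv (pullbackForm g.form e.symm) y = 0

/-! ### The order of a map from `ℂ²` to a complex surface -/

/-- `d^c u = (i / 4π) (∂̄ - ∂) u`, that is `v ↦ -(1 / 4π) du(iv)`. -/
def dc (u : C2 → ℝ) (z : C2) : C2 [⋀^Fin 1]→L[ℝ] ℝ :=
  ContinuousAlternatingMap.ofSubsingleton ℝ C2 ℝ (0 : Fin 1)
    (-(1 / (4 * Real.pi)) • (fderiv ℝ u z).comp mulI)

/-- `α = dd^c ‖z‖²`. -/
def alphaForm (z : C2) : C2 [⋀^Fin 2]→L[ℝ] ℝ := extDeriv (dc fun z ↦ ‖z‖ ^ 2) z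

/-- The wedge product of two 2-forms, evaluated on four vectors (the sum over all
`(2,2)`-shuffles). -/
def wedgeApply (a b : C2 [⋀^Fin 2]→L[ℝ] ℝ) (v : Fin 4 → C2) : ℝ :=
  a ![v 0, v 1] * b ![v 2, v 3] - a ![v 0, v 2] * b ![v 1, v 3] + a ![v 0, v 3] * b ![v 1, v 2]
    + a ![v 1, v 2] * b ![v 0, v 3] - a ![v 1, v 3] * b ![v 0, v 2] + a ![v 2, v 3] * b ![v 0, v 1]

/-- The positively oriented orthonormal real basis `(e₁, ie₁, e₂, ie₂)` of `ℂ²`. -/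
def stdFrame : Fin 4 → C2 := ![!₂[1, 0], !₂[Complex.I, 0], !₂[0, 1], !₂[0, Complex.I]]

/-- The order function
`T_f(r; ω) = ∫_1^r t⁻³ (∫_{B(t)} f^* ω ∧ α) dt` of a map `f : ℂ² → X`. -/
def orderFunction [IsManifold 𝓘(ℝ, C2) ∞ X] (g : HermitianMetric X) (f : C2 → X) (r : ℝ) : ℝ :=
  ∫ t in (1 : ℝ)..r, (1 / t ^ 3) *
    ∫ z in Metric.ball (0 : C2) t, wedgeApply (pullbackForm g.form f z) (alphaForm z) stdFrame

/-- The order `ρ_f = limsup_{r → ∞} log T_f(r; ω) / log r`. -/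
def mapOrder [IsManifold 𝓘(ℝ, C2) ∞ X] (g : HermitianMetric X) (f : C2 → X) : EReal :=
  Filter.limsup (fun r : ℝ ↦ ((Real.log (orderFunction g f r) / Real.log r : ℝ) : EReal))
    Filter.atTop

/-- `f : ℂ² → X` is differentiably non-degenerate: the complex differential has maximal rank `2`
on a dense open set. -/
def IsDifferentiablyNondegenerate (f : C2 → X) : Prop :=
  ∃ U : Set C2, IsOpen U ∧ Dense U ∧ ∀ z ∈ U,
    Module.finrank ℂ (LinearMap.range (mfderiv 𝓘(ℂ, C2) 𝓘(ℂ, C2) f z).toLinearMap) = 2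

end ComplexSurface

/-! ### Hopf surfaces -/

/-- `ℂ² ∖ {0}`; the group `ℂˣ` acts on it by scalar multiplication. -/
abbrev PuncturedC2 : Type := {p : C2 // p ≠ 0}

lemma puncturedC2_isOpenEmbedding :
    Topology.IsOpenEmbedding (Subtype.val : PuncturedC2 → C2) :=
  isOpen_ne.isOpenEmbedding_subtypeVal

instance : Nonempty PuncturedC2 :=
  ⟨⟨!₂[1, 0], fun h ↦ one_ne_zero (congrArg (fun p : C2 ↦ p 0) h)⟩⟩

/-- `ℂ² ∖ {0}` as an open subset of `ℂ²`. -/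
instance : ChartedSpace C2 PuncturedC2 := puncturedC2_isOpenEmbedding.singletonChartedSpace

instance : LocallyCompactSpace PuncturedC2 :=
  puncturedC2_isOpenEmbedding.locallyCompactSpace

/-- A multiplier `λ ∈ ℂ` with `|λ| > 1`. -/
abbrev HopfMultiplier : Type := {l : ℂ // 1 < ‖l‖}

/-- The multiplier as a unit of `ℂ`. -/
def HopfMultiplier.unit (l : HopfMultiplier) : ℂˣ :=
  Units.mk0 l.1 (norm_pos_iff.1 (one_pos.trans l.2))

/-- The infinite cyclic group generated by `λ`; `λ ^ n` acts as `(x, y) ↦ (λ ^ n x, λ ^ n y)`. -/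
abbrev HopfGroup (l : HopfMultiplier) : Type := Subgroup.zpowers (HopfMultiplier.unit l)

lemma hopfGroup_val_smul {l : HopfMultiplier} (a : HopfGroup l) (p : PuncturedC2) :
    ((a • p : PuncturedC2) : C2) = ((a : ℂˣ) : ℂ) • (p : C2) := rfl

instance (l : HopfMultiplier) : ContinuousConstSMul (HopfGroup l) PuncturedC2 where
  continuous_const_smul _ :=
    Continuous.subtype_mk (continuous_const.smul continuous_subtype_val) _

instance (l : HopfMultiplier) : IsCancelSMul (HopfGroup l) PuncturedC2 where
  left_cancel' _ p q h := by
    simpa using h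
  right_cancel' a b p h := by
    have h' := congrArg Subtype.val h
    rw [hopfGroup_val_smul, hopfGroup_val_smul] at h'
    exact Subtype.ext (Units.ext (smul_left_injective ℂ p.2 h'))

lemma exists_norm_bounds {K : Set PuncturedC2} (hK : IsCompact K) :
    ∃ m M : ℝ, 0 < m ∧ 0 < M ∧ ∀ p ∈ K, m ≤ ‖(p : C2)‖ ∧ ‖(p : C2)‖ ≤ M := by
  rcases K.eq_empty_or_nonempty with rfl | hne
  · exact ⟨1, 1, one_pos, one_pos, by simp⟩
  have hc : ContinuousOn (fun p : PuncturedC2 ↦ ‖(p : C2)‖) K :=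
    (continuous_norm.comp continuous_subtype_val).continuousOn
  obtain ⟨a, -, ha⟩ := hK.exists_isMinOn hne hc
  obtain ⟨b, -, hb⟩ := hK.exists_isMaxOn hne hc
  exact ⟨_, _, norm_pos_iff.2 a.2, norm_pos_iff.2 b.2, fun p hp ↦ ⟨ha hp, hb hp⟩⟩

instance (l : HopfMultiplier) : ProperlyDiscontinuousSMul (HopfGroup l) PuncturedC2 where
  finite_disjoint_inter_image := by
    intro K L hK hL
    obtain ⟨m, M, hm, hM, hKb⟩ := exists_norm_bounds hK
    obtain ⟨m', M', hm', hM', hLb⟩ := exists_norm_bounds hL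
    have hl : 1 < ‖l.1‖ := l.2
    obtain ⟨N₁, h₁⟩ := pow_unbounded_of_one_lt (M' / m) hl
    obtain ⟨N₂, h₂⟩ := pow_unbounded_of_one_lt (M / m') hl
    refine ((Set.finite_Icc (-(N₂ : ℤ)) N₁).image
      (fun n : ℤ ↦ (⟨HopfMultiplier.unit l ^ n, n, rfl⟩ : HopfGroup l))).subset ?_
    rintro ⟨a, n, rfl⟩ ⟨q, ⟨p, hp, hpq⟩, hq⟩
    refine ⟨n, ?_, rfl⟩
    have hn : ‖(q : C2)‖ = ‖l.1‖ ^ n * ‖(p : C2)‖ := by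
      rw [← hpq]
      change ‖((HopfMultiplier.unit l ^ n : ℂˣ) : ℂ) • (p : C2)‖ = _
      rw [norm_smul, Units.val_zpow_eq_zpow_val, norm_zpow]
      rfl
    obtain ⟨hp₁, hp₂⟩ := hKb p hp
    obtain ⟨hq₁, hq₂⟩ := hLb q hq
    have hpos : 0 < ‖l.1‖ ^ n := zpow_pos (one_pos.trans hl) n
    constructor
    · have : ‖l.1‖ ^ (-n) < ‖l.1‖ ^ (N₂ : ℤ) := by
        rw [zpow_natCast]
        refine lt_of_le_of_lt ?_ h₂
        rw [zpow_neg, inv_le_comm₀ hpos (by positivity), inv_div, div_le_iff₀ hM]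
        nlinarith
      have := (zpow_lt_zpow_iff_right₀ hl).1 this
      omega
    · have : ‖l.1‖ ^ n < ‖l.1‖ ^ (N₁ : ℤ) := by
        rw [zpow_natCast]
        refine lt_of_le_of_lt ?_ h₁
        rw [le_div_iff₀ hm]
        nlinarith
      exact ((zpow_lt_zpow_iff_right₀ hl).1 this).le

/-- The Hopf surface `(ℂ² ∖ {0}) / ⟨λ⟩`, with the quotient topology and the charts given by the
local inverses of the quotient map. -/
abbrev HopfSurface (l : HopfMultiplier) : Type :=
  MulAction.orbitRel.Quotient (HopfGroup l) PuncturedC2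

/-- The quotient map `ℂ² ∖ {0} → S`. -/
def hopfMk (l : HopfMultiplier) (p : PuncturedC2) : HopfSurface l :=
  Quotient.mk (MulAction.orbitRel (HopfGroup l) PuncturedC2) p

lemma hopfMk_smul (l : HopfMultiplier) (a : HopfGroup l) (p : PuncturedC2) :
    hopfMk l (a • p) = hopfMk l p :=
  Quotient.sound ⟨a, rfl⟩

lemma hopf_atlas_symm {l : HopfMultiplier} {e : OpenPartialHomeomorph (HopfSurface l) C2}
    (he : e ∈ atlas C2 (HopfSurface l)) {y : C2} (hy : y ∈ e.target) :
    ∃ p : PuncturedC2, (p : C2) = y ∧ e.symm y = hopfMk l p := by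
  obtain ⟨q, rfl⟩ := he
  refine ⟨_, (chartAt C2 _).right_inv hy.1, ?_⟩
  rw [OpenPartialHomeomorph.coe_trans_symm, Function.comp_apply,
    IsLocalHomeomorph.localInverseAt_symm]
  rfl

lemma hopf_transition {l : HopfMultiplier} {e e' : OpenPartialHomeomorph (HopfSurface l) C2}
    (he : e ∈ atlas C2 (HopfSurface l)) (he' : e' ∈ atlas C2 (HopfSurface l)) {y : C2}
    (hy : y ∈ (e.symm.trans e').source) :
    ∃ c : ℂ, (e.symm.trans e' : C2 → C2) =ᶠ[nhds y] fun x ↦ c • x := by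
  obtain ⟨hy₁, hy₂⟩ := hy
  obtain ⟨p, hp, hpe⟩ := hopf_atlas_symm he hy₁
  obtain ⟨q, hq, hqe⟩ := hopf_atlas_symm he' (e'.map_source hy₂)
  rw [e'.left_inv hy₂] at hqe
  have hpq : hopfMk l q = hopfMk l p := hqe.symm.trans hpe
  obtain ⟨a, ha⟩ := Quotient.exact hpq
  have ha' : ((a : ℂˣ) : ℂ) • y = e' (e.symm y) := by
    rw [← hp, ← hopfGroup_val_smul]
    refine (congrArg Subtype.val ha).trans (hq.trans ?_)
    rw [hp]
    rfl
  refine ⟨((a : ℂˣ) : ℂ), ?_⟩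
  have h₂ : ∀ᶠ x in nhds y, ((a : ℂˣ) : ℂ) • x ∈ e'.target := by
    refine (continuous_const_smul ((a : ℂˣ) : ℂ)).continuousAt.eventually ?_
    refine e'.open_target.mem_nhds ?_
    change ((a : ℂˣ) : ℂ) • y ∈ e'.target
    rw [ha']
    exact e'.map_source hy₂
  filter_upwards [e.open_target.mem_nhds hy₁, h₂] with x hx₁ hx₂
  obtain ⟨p', hp', hpe'⟩ := hopf_atlas_symm he hx₁
  obtain ⟨q', hq', hqe'⟩ := hopf_atlas_symm he' hx₂
  have hq'' : q' = a • p' := Subtype.ext (by rw [hopfGroup_val_smul, hp', hq'])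
  rw [OpenPartialHomeomorph.coe_trans, Function.comp_apply, hpe', ← hopfMk_smul l a p', ← hq'',
    ← hqe', e'.right_inv hx₂]

/-- The Hopf surface is a complex manifold. -/
instance (l : HopfMultiplier) : IsManifold 𝓘(ℂ, C2) ω (HopfSurface l) :=
  isManifold_of_contDiffOn _ _ _ fun e e' he he' y hy ↦ by
    obtain ⟨c, hc⟩ := hopf_transition he he' hy.1
    exact ((contDiff_const_smul c).contDiffAt.congr_of_eventuallyEq hc).contDiffWithinAt

instance (l : HopfMultiplier) : IsManifold 𝓘(ℝ, C2) ∞ (HopfSurface l) :=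
  isManifold_of_contDiffOn _ _ _ fun e e' he he' y hy ↦ by
    obtain ⟨c, hc⟩ := hopf_transition he he' hy.1
    exact ((contDiff_const_smul c).contDiffAt.congr_of_eventuallyEq hc).contDiffWithinAt

end

noncomputable section

open Topology Filter

/-! ### The quotient map of a Hopf surface -/

/-- The quotient map `ℂ² ∖ {0} → S`, extended to `ℂ²` by an arbitrary value at the origin. -/
def hopfProj (l : HopfMultiplier) (z : C2) : HopfSurface l :=
  open Classical in
  if h : z ≠ 0 then hopfMk l ⟨z, h⟩ else hopfMk l (Classical.arbitrary _)

lemma hopfProj_of_ne (l : HopfMultiplier) {z : C2} (h : z ≠ 0) :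
    hopfProj l z = hopfMk l ⟨z, h⟩ := dif_pos h

lemma hopfProj_coe (l : HopfMultiplier) (p : PuncturedC2) :
    hopfProj l (p : C2) = hopfMk l p := hopfProj_of_ne l p.2

lemma continuous_hopfMk (l : HopfMultiplier) : Continuous (hopfMk l) := continuous_quotient_mk'

lemma exists_hopfProj_eq {l : HopfMultiplier} (x : HopfSurface l) :
    ∃ p : C2, p ≠ 0 ∧ hopfProj l p = x := by
  obtain ⟨p, rfl⟩ := Quotient.exists_rep x
  exact ⟨p, p.2, hopfProj_coe l p⟩

lemma hopfProj_smul (l : HopfMultiplier) (a : HopfGroup l) {z : C2} (h : z ≠ 0) :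
    hopfProj l (((a : ℂˣ) : ℂ) • z) = hopfProj l z := by
  have := hopfMk_smul l a ⟨z, h⟩
  rw [← hopfProj_coe, ← hopfProj_coe, hopfGroup_val_smul] at this
  exact this

lemma hopfProj_zpow_smul (l : HopfMultiplier) (n : ℤ) {z : C2} (h : z ≠ 0) :
    hopfProj l ((l.1 ^ n) • z) = hopfProj l z := by
  have := hopfProj_smul l ⟨HopfMultiplier.unit l ^ n, n, rfl⟩ h
  rw [← this]
  simp [HopfMultiplier.unit]

lemma symm_eventuallyEq_hopfProj {l : HopfMultiplier}
    {e : OpenPartialHomeomorph (HopfSurface l) C2} (he : e ∈ atlas C2 (HopfSurface l)) {y : C2}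
    (hy : y ∈ e.target) : e.symm =ᶠ[𝓝 y] hopfProj l := by
  filter_upwards [e.open_target.mem_nhds hy] with x hx
  obtain ⟨p, rfl, hpe⟩ := hopf_atlas_symm he hx
  rw [hpe, hopfProj_coe]

lemma ne_zero_of_mem_target {l : HopfMultiplier}
    {e : OpenPartialHomeomorph (HopfSurface l) C2} (he : e ∈ atlas C2 (HopfSurface l)) {y : C2}
    (hy : y ∈ e.target) : y ≠ 0 := by
  obtain ⟨p, rfl, -⟩ := hopf_atlas_symm he hy
  exact p.2

/-- In any chart, the quotient map is locally the multiplication by a nonzero scalar. -/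
lemma hopfProj_in_chart {l : HopfMultiplier} {e : OpenPartialHomeomorph (HopfSurface l) C2}
    (he : e ∈ atlas C2 (HopfSurface l)) {p : C2} (hp : p ≠ 0) (hpe : hopfProj l p ∈ e.source) :
    ∃ a : HopfGroup l, e (hopfProj l p) = ((a : ℂˣ) : ℂ) • p ∧
      ∀ᶠ x in 𝓝 p, ((a : ℂˣ) : ℂ) • x ∈ e.target ∧
        hopfProj l x = e.symm (((a : ℂˣ) : ℂ) • x) := by
  obtain ⟨q, hq, hqe⟩ := hopf_atlas_symm he (e.map_source hpe)
  rw [e.left_inv hpe, hopfProj_of_ne l hp] at hqe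
  obtain ⟨a, ha⟩ := Quotient.exact hqe.symm
  have ha' : ((a : ℂˣ) : ℂ) • p = e (hopfProj l p) := by
    rw [← hq]
    exact congrArg Subtype.val ha
  refine ⟨a, ha'.symm, ?_⟩
  have h₂ : ∀ᶠ x in 𝓝 p, ((a : ℂˣ) : ℂ) • x ∈ e.target := by
    refine (continuous_const_smul ((a : ℂˣ) : ℂ)).continuousAt.eventually ?_
    refine e.open_target.mem_nhds ?_
    change ((a : ℂˣ) : ℂ) • p ∈ e.target
    rw [ha']
    exact e.map_source hpe
  filter_upwards [h₂, isOpen_ne.mem_nhds hp] with x hx hx0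
  refine ⟨hx, ?_⟩
  obtain ⟨q', hq', hqe'⟩ := hopf_atlas_symm he hx
  rw [hqe', ← hopfProj_coe, hq', hopfProj_smul l a hx0]

lemma hopfProj_eventuallyEq_comp {l : HopfMultiplier}
    {e : OpenPartialHomeomorph (HopfSurface l) C2}
    (he : e ∈ atlas C2 (HopfSurface l)) {p : C2} (hp : p ≠ 0) (hpe : hopfProj l p ∈ e.source) :
    ∃ a : HopfGroup l, e (hopfProj l p) = ((a : ℂˣ) : ℂ) • p ∧
      (fun x ↦ e (hopfProj l x)) =ᶠ[𝓝 p] fun x ↦ ((a : ℂˣ) : ℂ) • x := by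
  obtain ⟨a, ha, h⟩ := hopfProj_in_chart he hp hpe
  refine ⟨a, ha, ?_⟩
  filter_upwards [h] with x hx
  rw [hx.2, e.right_inv hx.1]

section Smoothness

variable {𝕜 : Type*} [NontriviallyNormedField 𝕜] [NormedAlgebra 𝕜 ℂ]
  {n : WithTop ℕ∞}

lemma contMDiffAt_hopfProj (l : HopfMultiplier)
    [IsManifold 𝓘(𝕜, C2) n (HopfSurface l)] {p : C2}
    (hp : p ≠ 0) : ContMDiffAt 𝓘(𝕜, C2) 𝓘(𝕜, C2) n (hopfProj l) p := by
  obtain ⟨a, ha, h⟩ := hopfProj_in_chart (chart_mem_atlas C2 (hopfProj l p)) hp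
    (mem_chart_source C2 _)
  refine ContMDiffAt.congr_of_eventuallyEq ?_ (h.mono fun x hx ↦ hx.2)
  have h1 : ContMDiffAt 𝓘(𝕜, C2) 𝓘(𝕜, C2) n (chartAt C2 (hopfProj l p)).symm
      (((a : ℂˣ) : ℂ) • p) :=
    (contMDiffOn_chart_symm (x := hopfProj l p)).contMDiffAt
      ((chartAt C2 (hopfProj l p)).open_target.mem_nhds h.self_of_nhds.1)
  exact ContMDiffAt.comp p h1 (contDiff_const_smul ((a : ℂˣ) : ℂ)).contMDiff.contMDiffAt

lemma hasMFDerivAt_hopfProj (l : HopfMultiplier) {p : C2} (hp : p ≠ 0) :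
    ∃ a : HopfGroup l, chartAt C2 (hopfProj l p) (hopfProj l p) = ((a : ℂˣ) : ℂ) • p ∧
      HasMFDerivAt 𝓘(𝕜, C2) 𝓘(𝕜, C2) (hopfProj l) p
        (show C2 →L[𝕜] C2 from ((a : ℂˣ) : ℂ) • ContinuousLinearMap.id 𝕜 C2) := by
  obtain ⟨a, ha, h⟩ := hopfProj_eventuallyEq_comp (chart_mem_atlas C2 (hopfProj l p)) hp
    (mem_chart_source C2 _)
  refine ⟨a, ha, (contMDiffAt_hopfProj (𝕜 := 𝕜) (n := 0) l hp).continuousAt, ?_⟩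
  have h2 : HasFDerivAt (fun x : C2 ↦ ((a : ℂˣ) : ℂ) • x)
      (((a : ℂˣ) : ℂ) • ContinuousLinearMap.id 𝕜 C2) p :=
    (((a : ℂˣ) : ℂ) • ContinuousLinearMap.id 𝕜 C2).hasFDerivAt
  exact (h2.congr_of_eventuallyEq h).hasFDerivWithinAt

end Smoothness

/-! ### Topology of Hopf surfaces -/

lemma exists_zpow_norm_mem_Icc (l : HopfMultiplier) {p : C2} (hp : p ≠ 0) :
    ∃ n : ℤ, 1 ≤ ‖l.1 ^ n • p‖ ∧ ‖l.1 ^ n • p‖ ≤ ‖l.1‖ := by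
  have hp' : 0 < ‖p‖ := norm_pos_iff.2 hp
  obtain ⟨n, hn₁, hn₂⟩ := exists_mem_Ico_zpow hp' l.2
  have hl : 0 < ‖l.1‖ := one_pos.trans l.2
  refine ⟨-n, ?_, ?_⟩
  · rw [norm_smul, norm_zpow, zpow_neg, ← div_eq_inv_mul, one_le_div (zpow_pos hl n)]
    exact hn₁
  · rw [norm_smul, norm_zpow, zpow_neg, ← div_eq_inv_mul, div_le_iff₀ (zpow_pos hl n),
      ← zpow_one_add₀ hl.ne', add_comm]
    exact hn₂.le

/-- The closed shell `1 ≤ ‖p‖ ≤ |λ|`, which meets every orbit. -/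
def hopfShell (l : HopfMultiplier) : Set C2 := {p | 1 ≤ ‖p‖ ∧ ‖p‖ ≤ ‖l.1‖}

lemma isCompact_hopfShell (l : HopfMultiplier) : IsCompact (hopfShell l) := by
  refine (isCompact_closedBall (0 : C2) ‖l.1‖).of_isClosed_subset ?_ fun p hp ↦ by
    simpa using hp.2
  exact (isClosed_le continuous_const continuous_norm).inter
    (isClosed_le continuous_norm continuous_const)

lemma ne_zero_of_mem_hopfShell {l : HopfMultiplier} {p : C2} (hp : p ∈ hopfShell l) : p ≠ 0 :=
  norm_pos_iff.1 (one_pos.trans_le hp.1)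

lemma hopfProj_image_hopfShell (l : HopfMultiplier) :
    Set.image (hopfProj l) (hopfShell l) = Set.univ := by
  refine Set.eq_univ_of_forall fun x ↦ ?_
  obtain ⟨p, hp, rfl⟩ := exists_hopfProj_eq x
  obtain ⟨n, hn⟩ := exists_zpow_norm_mem_Icc l hp
  exact ⟨_, hn, hopfProj_zpow_smul l n hp⟩

lemma compactSpace_hopfSurface (l : HopfMultiplier) : CompactSpace (HopfSurface l) := by
  refine ⟨?_⟩
  rw [← hopfProj_image_hopfShell l]
  refine (isCompact_hopfShell l).image_of_continuousOn fun p hp ↦ ContinuousAt.continuousWithinAt ?_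
  exact (contMDiffAt_hopfProj (𝕜 := ℂ) (n := ω) l (ne_zero_of_mem_hopfShell hp)).continuousAt

lemma connectedSpace_hopfSurface (l : HopfMultiplier) : ConnectedSpace (HopfSurface l) := by
  have h : IsConnected ({0}ᶜ : Set C2) := by
    refine isConnected_compl_singleton_of_one_lt_rank ?_ 0
    rw [← Module.finrank_eq_rank]
    have : Module.finrank ℝ C2 = 4 := by
      rw [← Module.finrank_mul_finrank ℝ ℂ C2, Complex.finrank_real_complex,
        finrank_euclideanSpace_fin]
    rw [this]
    norm_num
  have : ConnectedSpace PuncturedC2 := isConnected_iff_connectedSpace.1 h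
  exact Quotient.mk_surjective.connectedSpace (continuous_hopfMk l)

lemma t2Space_hopfSurface (l : HopfMultiplier) : T2Space (HopfSurface l) :=
  t2Space_of_properlyDiscontinuousSMul_of_t2Space

/-! ### The lift of a hermitian metric to `ℂ² ∖ {0}` -/

variable {l : HopfMultiplier}

/-- The pull-back of a hermitian metric by the quotient map. -/
def hermLift (g : HermitianMetric (HopfSurface l)) (p : C2) : C2 →L[ℝ] C2 →L[ℝ] ℝ :=
  (show C2 →L[ℝ] C2 →L[ℝ] ℝ from g.inner (hopfProj l p)).bilinearComp
    (show C2 →L[ℝ] C2 from mfderiv 𝓘(ℝ, C2) 𝓘(ℝ, C2) (hopfProj l) p)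
    (show C2 →L[ℝ] C2 from mfderiv 𝓘(ℝ, C2) 𝓘(ℝ, C2) (hopfProj l) p)

lemma hermLift_apply (g : HermitianMetric (HopfSurface l)) (p u v : C2) :
    hermLift g p u v = g.inner (hopfProj l p) (mfderiv 𝓘(ℝ, C2) 𝓘(ℝ, C2) (hopfProj l) p u)
      (mfderiv 𝓘(ℝ, C2) 𝓘(ℝ, C2) (hopfProj l) p v) := rfl

lemma exists_mfderiv_hopfProj (l : HopfMultiplier) {p : C2} (hp : p ≠ 0) :
    ∃ c : ℂ, c ≠ 0 ∧ ∀ u : C2,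
      mfderiv 𝓘(ℝ, C2) 𝓘(ℝ, C2) (hopfProj l) p u = (c • u : C2) := by
  obtain ⟨a, -, h⟩ := hasMFDerivAt_hopfProj (𝕜 := ℝ) l hp
  refine ⟨((a : ℂˣ) : ℂ), (a : ℂˣ).ne_zero, fun u ↦ ?_⟩
  rw [h.mfderiv]
  rfl

lemma hermLift_symm (g : HermitianMetric (HopfSurface l)) (p u v : C2) :
    hermLift g p u v = hermLift g p v u := g.symm _ _ _

lemma hermLift_I (g : HermitianMetric (HopfSurface l)) {p : C2} (hp : p ≠ 0) (u v : C2) :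
    hermLift g p (Complex.I • u) (Complex.I • v) = hermLift g p u v := by
  obtain ⟨c, -, hc⟩ := exists_mfderiv_hopfProj l hp
  simp only [hermLift_apply, hc]
  rw [smul_comm c, smul_comm c]
  exact g.inner_J _ _ _

lemma hermLift_self_I (g : HermitianMetric (HopfSurface l)) {p : C2} (hp : p ≠ 0) (u : C2) :
    hermLift g p u (Complex.I • u) = 0 := by
  have h := hermLift_I g hp u (Complex.I • u)
  rw [smul_smul, Complex.I_mul_I, neg_one_smul, map_neg, hermLift_symm g p _ u] at h
  linarith

lemma hermLift_pos (g : HermitianMetric (HopfSurface l)) {p : C2} (hp : p ≠ 0) {u : C2}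
    (hu : u ≠ 0) : 0 < hermLift g p u u := by
  obtain ⟨c, hc0, hc⟩ := exists_mfderiv_hopfProj l hp
  simp only [hermLift_apply, hc]
  exact g.pos _ _ (smul_ne_zero hc0 hu)

lemma mfderiv_hopfProj_zpow_smul (l : HopfMultiplier) (n : ℤ) {p : C2} (hp : p ≠ 0) (u : C2) :
    (mfderiv 𝓘(ℝ, C2) 𝓘(ℝ, C2) (hopfProj l) (l.1 ^ n • p) (l.1 ^ n • u) : C2) =
      mfderiv 𝓘(ℝ, C2) 𝓘(ℝ, C2) (hopfProj l) p u := by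
  have hl : l.1 ≠ 0 := norm_pos_iff.1 (one_pos.trans l.2)
  have hp' : l.1 ^ n • p ≠ 0 := smul_ne_zero (zpow_ne_zero n hl) hp
  have h1 : HasMFDerivAt 𝓘(ℝ, C2) 𝓘(ℝ, C2) (fun x : C2 ↦ l.1 ^ n • x) p
      (show C2 →L[ℝ] C2 from l.1 ^ n • ContinuousLinearMap.id ℝ C2) :=
    (show C2 →L[ℝ] C2 from l.1 ^ n • ContinuousLinearMap.id ℝ C2).hasFDerivAt.hasMFDerivAt
  have h2 : MDifferentiableAt 𝓘(ℝ, C2) 𝓘(ℝ, C2) (hopfProj l) (l.1 ^ n • p) :=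
    (contMDiffAt_hopfProj (𝕜 := ℝ) (n := ∞) l hp').mdifferentiableAt (by simp)
  have h3 := HasMFDerivAt.comp p h2.hasMFDerivAt h1
  have h4 : hopfProj l ∘ (fun x : C2 ↦ l.1 ^ n • x) =ᶠ[𝓝 p] hopfProj l := by
    filter_upwards [isOpen_ne.mem_nhds hp] with x hx
    exact hopfProj_zpow_smul l n hx
  rw [← h4.mfderiv_eq, h3.mfderiv]
  rfl

lemma hermLift_zpow_smul (g : HermitianMetric (HopfSurface l)) (n : ℤ) {p : C2} (hp : p ≠ 0)
    (u v : C2) : hermLift g (l.1 ^ n • p) (l.1 ^ n • u) (l.1 ^ n • v) = hermLift g p u v := by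
  have key : ∀ x y : HopfSurface l, x = y → ∀ a b c d : C2, a = c → b = d →
      g.inner x a b = g.inner y c d := by
    rintro x _ rfl a b _ _ rfl rfl
    rfl
  exact key _ _ (hopfProj_zpow_smul l n hp) _ _ _ _ (mfderiv_hopfProj_zpow_smul l n hp u)
    (mfderiv_hopfProj_zpow_smul l n hp v)

lemma contMDiffOn_hopfProj (l : HopfMultiplier) :
    ContMDiffOn 𝓘(ℝ, C2) 𝓘(ℝ, C2) ∞ (hopfProj l) {0}ᶜ := fun _ hp ↦
  (contMDiffAt_hopfProj (𝕜 := ℝ) (n := ∞) l hp).contMDiffWithinAt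

lemma contMDiffOn_mfderiv_hopfProj (l : HopfMultiplier) (u : C2) :
    ContMDiffOn 𝓘(ℝ, C2) (𝓘(ℝ, C2).prod 𝓘(ℝ, C2)) ∞ (fun x : C2 ↦
      Bundle.TotalSpace.mk' C2 (E := fun x : HopfSurface l ↦ TangentSpace 𝓘(ℝ, C2) x)
        (hopfProj l x) (mfderiv 𝓘(ℝ, C2) 𝓘(ℝ, C2) (hopfProj l) x u)) {0}ᶜ := by
  have ho : IsOpen ({0}ᶜ : Set C2) := isOpen_compl_singleton
  have h1 := (contMDiffOn_hopfProj l).contMDiffOn_tangentMapWithin (m := ∞) (by simp)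
    ho.uniqueMDiffOn
  have h2 : ContMDiffOn 𝓘(ℝ, C2) (𝓘(ℝ, C2).prod 𝓘(ℝ, C2)) ∞
      (fun x : C2 ↦ (⟨x, u⟩ : TangentBundle 𝓘(ℝ, C2) C2)) {0}ᶜ :=
    contMDiffOn_vectorSpace_iff_contDiffOn.2 contDiffOn_const
  refine (h1.comp h2 fun x hx ↦ hx).congr fun x hx ↦ ?_
  change _ = (⟨hopfProj l x, mfderivWithin 𝓘(ℝ, C2) 𝓘(ℝ, C2) (hopfProj l) {0}ᶜ x u⟩ :
    TangentBundle 𝓘(ℝ, C2) (HopfSurface l))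
  rw [mfderivWithin_of_isOpen ho hx]

lemma contDiffOn_hermLift (g : HermitianMetric (HopfSurface l)) :
    ContDiffOn ℝ ∞ (hermLift g) {0}ᶜ := by
  refine contDiffOn_clm_apply.2 fun u ↦ contDiffOn_clm_apply.2 fun v ↦ ?_
  have h4 : ContMDiffOn 𝓘(ℝ, C2) (𝓘(ℝ, C2).prod 𝓘(ℝ)) ∞ (fun x : C2 ↦
      Bundle.TotalSpace.mk' ℝ (E := Bundle.Trivial (HopfSurface l) ℝ) (hopfProj l x)
        (hermLift g x u v)) {0}ᶜ :=
    ContMDiffOn.clm_bundle_apply₂ (F₁ := C2) (F₂ := C2)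
      (g.contMDiff.comp_contMDiffOn (contMDiffOn_hopfProj l))
      (contMDiffOn_mfderiv_hopfProj l u) (contMDiffOn_mfderiv_hopfProj l v)
  rw [← contMDiffOn_iff_contDiffOn]
  intro x hx
  have h5 := h4 x hx
  simp only [Bundle.contMDiffWithinAt_totalSpace] at h5
  exact h5.2

attribute [irreducible] hermLift

/-! ### The standard hermitian metric of a Hopf surface -/

lemma chartAt_ne_zero (x y : HopfSurface l) (hy : y ∈ (chartAt C2 x).source) :
    chartAt C2 x y ≠ 0 :=
  ne_zero_of_mem_target (chart_mem_atlas C2 x) ((chartAt C2 x).map_source hy)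

/-- The real inner product of `ℂ²` as a bilinear form. -/
def realInner : C2 →L[ℝ] C2 →L[ℝ] ℝ := innerSL ℝ

lemma realInner_self (u : C2) : realInner u u = ‖u‖ ^ 2 := real_inner_self_eq_norm_sq u

lemma realInner_symm (u v : C2) : realInner u v = realInner v u := real_inner_comm v u

lemma realInner_smul (c : ℂ) (u v : C2) :
    realInner (c • u) (c • v) = ‖c‖ ^ 2 * realInner u v := by
  have h : ∀ u : C2, realInner (c • u) (c • u) = ‖c‖ ^ 2 * realInner u u := fun u ↦ by
    rw [realInner_self, realInner_self, norm_smul, mul_pow]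
  have h1 := h (u + v)
  simp only [smul_add, map_add, add_apply, h] at h1
  rw [realInner_symm v u, realInner_symm (c • v) (c • u)] at h1
  linarith

/-- The metric `⟨u, v⟩ / ‖p‖²` in the preferred charts. -/
def stdInner (x : HopfSurface l) :
    TangentSpace 𝓘(ℝ, C2) x →L[ℝ] TangentSpace 𝓘(ℝ, C2) x →L[ℝ] ℝ :=
  show C2 →L[ℝ] C2 →L[ℝ] ℝ from (‖chartAt C2 x x‖ ^ 2)⁻¹ • realInner

lemma exists_tangentCoordChange {x y : HopfSurface l} (hy : y ∈ (chartAt C2 x).source) :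
    ∃ c : ℂ, chartAt C2 y y = c • chartAt C2 x y ∧
      ∀ u : C2, tangentCoordChange 𝓘(ℝ, C2) x y y u = c • u := by
  have hs : chartAt C2 x y ∈ ((chartAt C2 x).symm.trans (chartAt C2 y)).source := by
    refine ⟨(chartAt C2 x).map_source hy, ?_⟩
    change (chartAt C2 x).symm (chartAt C2 x y) ∈ (chartAt C2 y).source
    rw [(chartAt C2 x).left_inv hy]
    exact mem_chart_source C2 y
  obtain ⟨c, hc⟩ := hopf_transition (chart_mem_atlas C2 x) (chart_mem_atlas C2 y) hs
  refine ⟨c, ?_, fun u ↦ ?_⟩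
  · have := hc.self_of_nhds
    rwa [OpenPartialHomeomorph.coe_trans, Function.comp_apply, (chartAt C2 x).left_inv hy] at this
  · have h2 : HasFDerivAt (fun x : C2 ↦ c • x) (c • ContinuousLinearMap.id ℝ C2)
        (chartAt C2 x y) := (c • ContinuousLinearMap.id ℝ C2).hasFDerivAt
    have h3 := (h2.congr_of_eventuallyEq hc).fderiv
    rw [tangentCoordChange_def]
    simp only [extChartAt, mfld_simps, fderivWithin_univ]
    refine (congrArg (fun L : C2 →L[ℝ] C2 ↦ L u) h3).trans ?_
    rfl

lemma contMDiff_stdInner : ContMDiff 𝓘(ℝ, C2) (𝓘(ℝ, C2).prod 𝓘(ℝ, C2 →L[ℝ] C2 →L[ℝ] ℝ)) ∞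
    (fun x : HopfSurface l ↦ Bundle.TotalSpace.mk' (C2 →L[ℝ] C2 →L[ℝ] ℝ)
      (E := fun x : HopfSurface l ↦ TangentSpace 𝓘(ℝ, C2) x →L[ℝ] TangentSpace 𝓘(ℝ, C2) x →L[ℝ] ℝ)
       x (stdInner x)) := by
  intro x
  rw [Bundle.contMDiffAt_section]
  have h : ContMDiffAt 𝓘(ℝ, C2) 𝓘(ℝ, C2 →L[ℝ] C2 →L[ℝ] ℝ) ∞
      (fun y : HopfSurface l ↦ (‖chartAt C2 x y‖ ^ 2)⁻¹ • realInner) x := by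
    have h0 : ContDiffOn ℝ ∞ (fun z : C2 ↦ (‖z‖ ^ 2)⁻¹ • realInner) {0}ᶜ := by
      refine contDiffOn_clm_apply.2 fun u ↦ contDiffOn_clm_apply.2 fun v ↦ ?_
      refine ContDiffOn.mul (ContDiffOn.inv (contDiff_norm_sq ℝ).contDiffOn fun z hz ↦ ?_)
        contDiffOn_const
      simpa using hz
    have h1 := h0.contDiffAt (isOpen_compl_singleton.mem_nhds
      (chartAt_ne_zero x x (mem_chart_source C2 x)))
    exact h1.contMDiffAt.comp x (contMDiffAt_extChartAt (I := 𝓘(ℝ, C2)))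
  refine h.congr_of_eventuallyEq ?_
  filter_upwards [(chartAt C2 x).open_source.mem_nhds (mem_chart_source C2 x)] with y hy
  ext u v
  have hb : y ∈ (trivializationAt C2 (TangentSpace 𝓘(ℝ, C2)) x).baseSet := by
    simpa using hy
  obtain ⟨c, hc, hu⟩ := exists_tangentCoordChange hy
  have hsymm : ∀ u : C2, (trivializationAt C2 (TangentSpace 𝓘(ℝ, C2)) x).symm y u =
      (c • u : C2) := by
    intro u
    refine Eq.trans ?_ (hu u)
    refine (Bundle.Trivialization.symmL_apply (R := ℝ) _ hb _).symm.trans ?_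
    exact congrArg (fun L : C2 →L[ℝ] C2 ↦ L u)
      (TangentBundle.symmL_trivializationAt_eq_core (I := 𝓘(ℝ, C2)) hy)
  rw [hom_trivializationAt_apply]
  refine (inCoordinates_apply_eq₂ (E₃ := fun _ : HopfSurface l ↦ ℝ)
    hb hb (Set.mem_univ _)).trans ?_
  rw [hsymm, hsymm]
  have h5 : stdInner y (c • u : C2) (c • v : C2) = (‖chartAt C2 x y‖ ^ 2)⁻¹ • realInner u v := by
    change (‖chartAt C2 y y‖ ^ 2)⁻¹ * realInner (c • u) (c • v) = _
    have hc0 : c ≠ 0 := by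
      rintro rfl
      exact chartAt_ne_zero y y (mem_chart_source C2 y) (by simpa using hc)
    have := norm_pos_iff.2 hc0
    have := norm_pos_iff.2 (chartAt_ne_zero x y hy)
    rw [hc, norm_smul, realInner_smul, smul_eq_mul]
    field_simp
  refine Eq.trans ?_ h5
  simp

/-- The hermitian metric induced by `⟨u, v⟩ / ‖p‖²`. -/
def stdHermitianMetric (l : HopfMultiplier) : HermitianMetric (HopfSurface l) where
  inner := stdInner
  symm x u v := congrArg ((‖chartAt C2 x x‖ ^ 2)⁻¹ * ·) (realInner_symm u v)
  pos x u hu := by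
    have h : 0 < realInner (show C2 from u) (show C2 from u) := by
      rw [realInner_self]
      exact pow_pos (norm_pos_iff.2 hu) 2
    have := norm_pos_iff.2 (chartAt_ne_zero x x (mem_chart_source C2 x))
    exact mul_pos (by positivity) h
  isVonNBounded x := by
    change Bornology.IsVonNBounded ℝ
      {v : C2 | (‖chartAt C2 x x‖ ^ 2)⁻¹ * realInner (v : C2) (v : C2) < 1}
    refine (NormedSpace.isVonNBounded_ball ℝ C2 ‖chartAt C2 x x‖).subset fun v hv ↦ ?_
    have h0 := norm_pos_iff.2 (chartAt_ne_zero x x (mem_chart_source C2 x))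
    rw [Set.mem_ofPred_eq, realInner_self, inv_mul_lt_iff₀ (by positivity), mul_one] at hv
    rw [mem_ball_zero_iff]
    exact lt_of_pow_lt_pow_left₀ 2 h0.le hv
  contMDiff := contMDiff_stdInner
  inner_J x u v := by
    have h : realInner (Complex.I • (show C2 from u)) (Complex.I • (show C2 from v)) =
        realInner (show C2 from u) (show C2 from v) := by
      rw [realInner_smul, Complex.norm_I, one_pow, one_mul]
    exact congrArg ((‖chartAt C2 x x‖ ^ 2)⁻¹ * ·) h

/-! ### The lift of the metric form -/

/-- A map into the alternating forms on a finite-dimensional space is differentiable if all its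
evaluations are. -/
lemma differentiableAt_alternating {E M F : Type*} [NormedAddCommGroup E] [NormedSpace ℝ E]
    [NormedAddCommGroup M] [NormedSpace ℝ M] [FiniteDimensional ℝ M] [NormedAddCommGroup F]
    [NormedSpace ℝ F] [FiniteDimensional ℝ F] {n : ℕ} {η : E → M [⋀^Fin n]→L[ℝ] F} {x : E}
    (h : ∀ v : Fin n → M, DifferentiableAt ℝ (fun y ↦ η y v) x) : DifferentiableAt ℝ η x := by
  let b := Module.finBasis ℝ M
  let ev : (M [⋀^Fin n]→L[ℝ] F) →ₗ[ℝ] ((Fin n → Fin (Module.finrank ℝ M)) → F) :=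
    { toFun := fun a s ↦ a fun i ↦ b (s i)
      map_add' := fun _ _ ↦ rfl
      map_smul' := fun _ _ ↦ rfl }
  have hev : LinearMap.ker ev = ⊥ := by
    refine LinearMap.ker_eq_bot.2 fun a a' haa ↦ ?_
    apply ContinuousAlternatingMap.toAlternatingMap_injective
    apply AlternatingMap.coe_multilinearMap_injective
    exact Module.Basis.ext_multilinear (fun _ ↦ b) fun s ↦ congrFun haa s
  obtain ⟨r, hr⟩ := ev.exists_leftInverse_of_injective hev
  have hη : η = fun y ↦ r.toContinuousLinearMap (ev (η y)) := by
    funext y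
    exact (LinearMap.congr_fun hr (η y)).symm
  rw [hη]
  refine r.toContinuousLinearMap.differentiableAt.comp x ?_
  exact differentiableAt_pi.2 fun s ↦ h _

/-- The pull-back of the metric form to `ℂ² ∖ {0}`. -/
def formLift (g : HermitianMetric (HopfSurface l)) : C2 → C2 [⋀^Fin 2]→L[ℝ] ℝ :=
  pullbackForm g.form (hopfProj l)

lemma formLift_apply (g : HermitianMetric (HopfSurface l)) {p : C2} (hp : p ≠ 0)
    (v : Fin 2 → C2) : formLift g p v = hermLift g p (Complex.I • v 0) (v 1) := by
  obtain ⟨c, -, hc⟩ := exists_mfderiv_hopfProj l hp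
  have h : tangentJ (hopfProj l p) (mfderiv 𝓘(ℝ, C2) 𝓘(ℝ, C2) (hopfProj l) p (v 0)) =
      mfderiv 𝓘(ℝ, C2) 𝓘(ℝ, C2) (hopfProj l) p (Complex.I • v 0) := by
    rw [hc, hc]
    exact smul_comm Complex.I c (v 0)
  rw [hermLift_apply, ← h]
  rfl

lemma differentiableAt_formLift (g : HermitianMetric (HopfSurface l)) {p : C2} (hp : p ≠ 0) :
    DifferentiableAt ℝ (formLift g) p := by
  refine differentiableAt_alternating fun v ↦ ?_
  have h : DifferentiableAt ℝ (hermLift g) p :=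
    ((contDiffOn_hermLift g).contDiffAt (isOpen_compl_singleton.mem_nhds hp)).differentiableAt
      (by simp)
  have h2 : DifferentiableAt ℝ (fun p ↦ hermLift g p (Complex.I • v 0) (v 1)) p :=
    (h.clm_apply (differentiableAt_const _)).clm_apply (differentiableAt_const _)
  refine h2.congr_of_eventuallyEq ?_
  filter_upwards [isOpen_ne.mem_nhds hp] with x hx
  exact formLift_apply g hx v

lemma formLift_zpow_smul (g : HermitianMetric (HopfSurface l)) (n : ℤ) {p : C2} (hp : p ≠ 0)
    (v : Fin 2 → C2) : formLift g (l.1 ^ n • p) (fun i ↦ l.1 ^ n • v i) = formLift g p v := by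
  have hl : l.1 ≠ 0 := norm_pos_iff.1 (one_pos.trans l.2)
  rw [formLift_apply g (smul_ne_zero (zpow_ne_zero n hl) hp), formLift_apply g hp,
    smul_comm Complex.I, hermLift_zpow_smul g n hp]

lemma extDeriv_formLift_of_closed {g : HermitianMetric (HopfSurface l)}
    (hg : ∀ e ∈ atlas C2 (HopfSurface l), ∀ y ∈ e.target,
      extDeriv (pullbackForm g.form e.symm) y = 0) {p : C2} (hp : p ≠ 0) :
    extDeriv (formLift g) p = 0 := by
  have he := chart_mem_atlas C2 (hopfProj l p)
  obtain ⟨⟨a, n, hn⟩, ha, -⟩ := hopfProj_in_chart he hp (mem_chart_source C2 _)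
  have hn' : ((a : ℂˣ) : ℂ) = l.1 ^ n := by
    rw [← hn]
    simp [HopfMultiplier.unit]
  have hy : l.1 ^ n • p ∈ (chartAt C2 (hopfProj l p)).target := by
    rw [← hn', ← ha]
    exact (chartAt C2 _).map_source (mem_chart_source C2 _)
  have h1 : pullbackForm g.form (chartAt C2 (hopfProj l p)).symm =ᶠ[𝓝 (l.1 ^ n • p)]
      formLift g := by
    filter_upwards [(symm_eventuallyEq_hopfProj he hy).eventuallyEq_nhds] with x hx
    have hd := hx.mfderiv_eq (I := 𝓘(ℝ, C2)) (I' := 𝓘(ℝ, C2))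
    have hxx := hx.self_of_nhds
    ext v
    have key : ∀ x y : HopfSurface l, x = y → ∀ a b c d : C2, a = c → b = d →
        g.inner x (tangentJ x a) b = g.inner y (tangentJ y c) d := by
      rintro x _ rfl a b _ _ rfl rfl
      rfl
    exact key _ _ hxx _ _ _ _ (congrArg (fun L : C2 →L[ℝ] C2 ↦ L (v 0)) hd)
      (congrArg (fun L : C2 →L[ℝ] C2 ↦ L (v 1)) hd)
  have h2 : extDeriv (formLift g) (l.1 ^ n • p) = 0 := by
    rw [← h1.extDeriv_eq]
    exact hg _ he _ hy
  let L : C2 →L[ℝ] C2 := l.1 ^ n • ContinuousLinearMap.id ℝ C2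
  have h3 : formLift g =ᶠ[𝓝 p]
      fun x ↦ (formLift g (L x)).compContinuousLinearMap (fderiv ℝ L x) := by
    filter_upwards [isOpen_ne.mem_nhds hp] with x hx
    ext v
    rw [L.fderiv]
    exact (formLift_zpow_smul g n hx v).symm
  have hLp : L p ≠ 0 := ne_zero_of_mem_target he hy
  rw [h3.extDeriv_eq, extDeriv_pullback (r := ω) (differentiableAt_formLift g hLp)
    L.contDiff.contDiffAt (by simp)]
  have h2' : extDeriv (formLift g) (L p) = 0 := h2
  rw [h2']
  rfl

/-! ### Hopf surfaces are not Kähler -/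

open MeasureTheory in
/-- Stokes' theorem for a closed form of degree `n` on a box of dimension `n + 1`. -/
lemma sum_integral_faces_of_closed {n : ℕ}
    {η : (Fin (n + 1) → ℝ) → (Fin (n + 1) → ℝ) [⋀^Fin n]→L[ℝ] ℝ}
    (hη : Differentiable ℝ η) (hd : ∀ x, extDeriv η x = 0) {a b : Fin (n + 1) → ℝ} (hab : a ≤ b) :
    ∑ i : Fin (n + 1),
      ((∫ y in Set.Icc (a ∘ i.succAbove) (b ∘ i.succAbove), (-1) ^ (i : ℕ) *
        η (i.insertNth (b i) y) (i.removeNth fun j ↦ (Pi.single j 1 : Fin (n + 1) → ℝ))) -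
      ∫ y in Set.Icc (a ∘ i.succAbove) (b ∘ i.succAbove), (-1) ^ (i : ℕ) *
        η (i.insertNth (a i) y) (i.removeNth fun j ↦ (Pi.single j 1 : Fin (n + 1) → ℝ))) = 0 := by
  let e : Fin (n + 1) → Fin (n + 1) → ℝ := fun j ↦ Pi.single j 1
  let f : (Fin (n + 1) → ℝ) → Fin (n + 1) → ℝ := fun x i ↦ (-1) ^ (i : ℕ) * η x (i.removeNth e)
  have hev : ∀ v : Fin n → Fin (n + 1) → ℝ, Differentiable ℝ fun x ↦ η x v := fun v x ↦
    (ContinuousAlternatingMap.apply ℝ (Fin (n + 1) → ℝ) ℝ v).differentiableAt.comp x (hη x)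
  have hfi : ∀ i, Differentiable ℝ fun x ↦ f x i := fun i ↦ (hev _).const_mul _
  have hf : Differentiable ℝ f := differentiable_pi.2 hfi
  have hdiv : ∀ x, ∑ i, fderiv ℝ f x (Pi.single i 1) i = 0 := by
    intro x
    have h1 := extDeriv_apply (hη x) e
    rw [hd x] at h1
    refine Eq.trans (Finset.sum_congr rfl fun i _ ↦ ?_) h1.symm
    rw [fderiv_pi fun i ↦ hfi i x, ContinuousLinearMap.pi_apply]
    change fderiv ℝ (fun x ↦ (-1) ^ (i : ℕ) * η x (i.removeNth e)) x _ = _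
    rw [fderiv_const_mul (hev _ x)]
    rw [smul_apply, smul_eq_mul, zsmul_eq_mul]
    push_cast
    rfl
  have key := integral_divergence_of_hasFDerivAt_off_countable a b hab f (fun x ↦ fderiv ℝ f x) ∅
    Set.countable_empty hf.continuous.continuousOn (fun x _ ↦ (hf x).hasFDerivAt)
    (by simp only [hdiv]; exact integrableOn_zero)
  simp only [hdiv, integral_zero] at key
  exact key.symm

/-- A homotopy that contracts the torus `{(x, 0)} / λ`, seen through the covering `ℂ² ∖ {0}`. -/
def torusHomotopy (l : HopfMultiplier) (x : Fin 3 → ℝ) : C2 :=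
  Complex.exp (x 2 * Complex.log l.1) •
    (((1 - x 0) * Complex.exp (x 1 * Complex.I)) • EuclideanSpace.single 0 1 +
      (x 0 : ℂ) • EuclideanSpace.single 1 1)

lemma contDiff_torusHomotopy (l : HopfMultiplier) : ContDiff ℝ ω (torusHomotopy l) := by
  have h : ∀ i, ContDiff ℝ ω (fun x : Fin 3 → ℝ ↦ (x i : ℂ)) := fun i ↦
    Complex.ofRealCLM.contDiff.comp (contDiff_apply ℝ ℝ i)
  have hexp : ContDiff ℝ ω Complex.exp := Complex.contDiff_exp
  refine (hexp.comp ((h 2).mul contDiff_const)).smul (((((contDiff_const.sub (h 0)).mul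
    (hexp.comp ((h 1).mul contDiff_const))).smul contDiff_const)).add ((h 0).smul contDiff_const))

lemma torusHomotopy_ne_zero (l : HopfMultiplier) (x : Fin 3 → ℝ) : torusHomotopy l x ≠ 0 := by
  intro h
  rw [torusHomotopy, smul_eq_zero_iff_right (Complex.exp_ne_zero _)] at h
  have h0 := congrArg (fun p : C2 ↦ p 0) h
  have h1 := congrArg (fun p : C2 ↦ p 1) h
  simp at h0 h1
  simp [h1] at h0

lemma torusHomotopy_add_one (l : HopfMultiplier) (x : Fin 3 → ℝ) (t : ℝ) :
    torusHomotopy l (x + t • Pi.single 2 1) =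
      Complex.exp (t * Complex.log l.1) • torusHomotopy l x := by
  have h : Complex.exp (((x 2 + t : ℝ) : ℂ) * Complex.log l.1) =
      Complex.exp (t * Complex.log l.1) * Complex.exp (x 2 * Complex.log l.1) := by
    rw [← Complex.exp_add]
    push_cast
    ring_nf
  simp only [torusHomotopy, smul_smul, ← h]
  simp

lemma torusHomotopy_add_circle (l : HopfMultiplier) (x : Fin 3 → ℝ) (t : ℝ) :
    torusHomotopy l (x + t • Pi.single 1 1) = Complex.exp (x 2 * Complex.log l.1) •
    (((1 - x 0) * (Complex.exp (t * Complex.I) * Complex.exp (x 1 * Complex.I))) •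
      EuclideanSpace.single 0 1 + (x 0 : ℂ) • EuclideanSpace.single 1 1) := by
  have h : Complex.exp (((x 1 + t : ℝ) : ℂ) * Complex.I) =
      Complex.exp (t * Complex.I) * Complex.exp (x 1 * Complex.I) := by
    rw [← Complex.exp_add]
    push_cast
    ring_nf
  simp only [torusHomotopy, ← h]
  simp

lemma fderiv_torusHomotopy_eq (l : HopfMultiplier) {x v : Fin 3 → ℝ} {w : C2}
    (h : HasDerivAt (fun t : ℝ ↦ torusHomotopy l (x + t • v)) w 0) :
    fderiv ℝ (torusHomotopy l) x v = w := by
  have hd : DifferentiableAt ℝ (torusHomotopy l) x :=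
    (contDiff_torusHomotopy l).contDiffAt.differentiableAt (by simp)
  rw [← hd.lineDeriv_eq_fderiv]
  exact h.deriv

lemma hasDerivAt_exp_smul (c : ℂ) (p : C2) :
    HasDerivAt (fun t : ℝ ↦ Complex.exp (t * c) • p) (c • p) 0 := by
  have h1 : HasDerivAt (fun t : ℝ ↦ Complex.exp (t * c)) c 0 := by
    have := ((Complex.ofRealCLM.hasDerivAt (x := (0 : ℝ))).mul_const c).cexp
    simpa using this
  exact h1.smul_const p

lemma fderiv_torusHomotopy_two (l : HopfMultiplier) (x : Fin 3 → ℝ) :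
    fderiv ℝ (torusHomotopy l) x (Pi.single 2 1) = Complex.log l.1 • torusHomotopy l x := by
  refine fderiv_torusHomotopy_eq l ?_
  simp only [torusHomotopy_add_one]
  exact hasDerivAt_exp_smul _ _

lemma fderiv_torusHomotopy_one_of_zero (l : HopfMultiplier) {x : Fin 3 → ℝ} (hx : x 0 = 0) :
    fderiv ℝ (torusHomotopy l) x (Pi.single 1 1) = Complex.I • torusHomotopy l x := by
  refine fderiv_torusHomotopy_eq l ?_
  have : ∀ t : ℝ, torusHomotopy l (x + t • Pi.single 1 1) =
      Complex.exp (t * Complex.I) • torusHomotopy l x := by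
    intro t
    rw [torusHomotopy_add_circle, torusHomotopy]
    simp [hx, smul_smul]
    ring_nf
  simp only [this]
  exact hasDerivAt_exp_smul _ _

lemma fderiv_torusHomotopy_one_of_one (l : HopfMultiplier) {x : Fin 3 → ℝ} (hx : x 0 = 1) :
    fderiv ℝ (torusHomotopy l) x (Pi.single 1 1) = 0 := by
  refine fderiv_torusHomotopy_eq l ?_
  simp only [torusHomotopy_add_circle, hx]
  simpa using hasDerivAt_const (0 : ℝ) _

/-- The pull-back of the metric form by `torusHomotopy`. -/
def torusForm (g : HermitianMetric (HopfSurface l)) (x : Fin 3 → ℝ) :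
    (Fin 3 → ℝ) [⋀^Fin 2]→L[ℝ] ℝ :=
  (formLift g (torusHomotopy l x)).compContinuousLinearMap (fderiv ℝ (torusHomotopy l) x)

lemma torusForm_apply (g : HermitianMetric (HopfSurface l)) (x : Fin 3 → ℝ)
    (v : Fin 2 → Fin 3 → ℝ) : torusForm g x v = hermLift g (torusHomotopy l x)
      (Complex.I • fderiv ℝ (torusHomotopy l) x (v 0)) (fderiv ℝ (torusHomotopy l) x (v 1)) := by
  rw [torusForm, ContinuousAlternatingMap.compContinuousLinearMap_apply,
    formLift_apply g (torusHomotopy_ne_zero l x)]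
  rfl

lemma differentiable_torusForm (g : HermitianMetric (HopfSurface l)) :
    Differentiable ℝ (torusForm g) := by
  intro x
  refine differentiableAt_alternating fun v ↦ ?_
  simp only [torusForm_apply]
  have h : DifferentiableAt ℝ (hermLift g) (torusHomotopy l x) :=
    ((contDiffOn_hermLift g).contDiffAt (isOpen_compl_singleton.mem_nhds
      (torusHomotopy_ne_zero l x))).differentiableAt (by simp)
  have hΦ : DifferentiableAt ℝ (torusHomotopy l) x :=
    (contDiff_torusHomotopy l).contDiffAt.differentiableAt (by simp)
  have hdΦ : ∀ w, DifferentiableAt ℝ (fun x ↦ fderiv ℝ (torusHomotopy l) x w) x := fun w ↦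
    (((contDiff_torusHomotopy l).fderiv_right (m := ω) (by simp)).differentiable
      (by simp) x).clm_apply (differentiableAt_const _)
  have hc : DifferentiableAt ℝ (hermLift g ∘ torusHomotopy l) x  :=
    DifferentiableAt.comp (G := C2 →L[ℝ] C2 →L[ℝ] ℝ) (g := hermLift g) x h hΦ
  exact (hc.clm_apply ((hdΦ _).const_smul Complex.I)).clm_apply (hdΦ _)

lemma torusForm_add_circle (g : HermitianMetric (HopfSurface l)) (x : Fin 3 → ℝ) :
    torusForm g (x + (2 * Real.pi) • Pi.single 1 1) = torusForm g x := by
  have h : ∀ y, torusHomotopy l (y + (2 * Real.pi) • Pi.single 1 1) = torusHomotopy l y := by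
    intro y
    rw [torusHomotopy_add_circle]
    push_cast
    rw [Complex.exp_two_pi_mul_I, one_mul]
    rfl
  have h2 : fderiv ℝ (torusHomotopy l) (x + (2 * Real.pi) • Pi.single 1 1) =
      fderiv ℝ (torusHomotopy l) x := by
    rw [← fderiv_comp_add_right]
    simp only [h]
  rw [torusForm, h, h2]
  rfl

lemma torusForm_add_one (g : HermitianMetric (HopfSurface l)) (x : Fin 3 → ℝ) :
    torusForm g (x + (1 : ℝ) • Pi.single 2 1) = torusForm g x := by
  have hl : l.1 ≠ 0 := norm_pos_iff.1 (one_pos.trans l.2)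
  have h : ∀ y, torusHomotopy l (y + (1 : ℝ) • Pi.single 2 1) = l.1 • torusHomotopy l y := by
    intro y
    rw [torusHomotopy_add_one, Complex.ofReal_one, one_mul, Complex.exp_log hl]
  have h2 : ∀ v, fderiv ℝ (torusHomotopy l) (x + (1 : ℝ) • Pi.single 2 1) v =
      l.1 • fderiv ℝ (torusHomotopy l) x v := by
    intro v
    rw [← fderiv_comp_add_right]
    simp only [h]
    rw [fderiv_fun_const_smul ((contDiff_torusHomotopy l).contDiffAt.differentiableAt (by simp))]
    rfl
  ext v
  rw [torusForm_apply, torusForm_apply, h, h2, h2, smul_comm Complex.I]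
  simpa using hermLift_zpow_smul g 1 (torusHomotopy_ne_zero l x)
    (Complex.I • fderiv ℝ (torusHomotopy l) x (v 0)) (fderiv ℝ (torusHomotopy l) x (v 1))

lemma torusForm_neg (g : HermitianMetric (HopfSurface l)) {x : Fin 3 → ℝ} (hx : x 0 = 0) :
    torusForm g x ![Pi.single 1 1, Pi.single 2 1] < 0 := by
  rw [torusForm_apply]
  simp only [Matrix.cons_val_zero, Matrix.cons_val_one]
  rw [fderiv_torusHomotopy_one_of_zero l hx, fderiv_torusHomotopy_two, smul_smul, Complex.I_mul_I,
    neg_one_smul]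
  have hne := torusHomotopy_ne_zero l x
  set p := torusHomotopy l x
  have h1 : Complex.log l.1 • p =
      (Complex.log l.1).re • p + (Complex.log l.1).im • Complex.I • p := by
    conv_lhs => rw [← Complex.re_add_im (Complex.log l.1)]
    rw [add_smul, mul_smul]
    rfl
  rw [h1, map_neg, neg_apply, map_add, map_smul, map_smul, hermLift_self_I g hne, smul_zero,
    add_zero, smul_eq_mul, neg_lt_zero, Complex.log_re]
  exact mul_pos (Real.log_pos l.2) (hermLift_pos g hne hne)

lemma insertNth_eq_add (i : Fin 3) (c : ℝ) (y : Fin 2 → ℝ) :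
    (i.insertNth c y : Fin 3 → ℝ) = i.insertNth (0 : ℝ) y + c • Pi.single i (1 : ℝ) := by
  ext j
  refine i.succAboveCases ?_ (fun k ↦ ?_) j
  · simp
  · simp [Fin.succAbove_ne]

open MeasureTheory in
theorem not_isKahler_hopfSurface (l : HopfMultiplier) : ¬ IsKahler (HopfSurface l) := by
  rintro ⟨g, hg⟩
  have hclosed : ∀ x, extDeriv (torusForm g) x = 0 := by
    intro x
    have hne := torusHomotopy_ne_zero l x
    unfold torusForm
    rw [extDeriv_pullback (r := ω) (differentiableAt_formLift g hne)
      (contDiff_torusHomotopy l).contDiffAt (by simp), extDeriv_formLift_of_closed hg hne]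
    rfl
  have hab : (![0, 0, 0] : Fin 3 → ℝ) ≤ ![1, 2 * Real.pi, 1] := by
    intro i
    fin_cases i
    · simp
    · simpa using Real.pi_pos.le
    · simp
  have key := sum_integral_faces_of_closed (differentiable_torusForm g) hclosed hab
  rw [Fin.sum_univ_three] at key
  have h1 : ∀ y : Fin 2 → ℝ, torusForm g ((1 : Fin 3).insertNth (2 * Real.pi) y) =
      torusForm g ((1 : Fin 3).insertNth 0 y) := fun y ↦ by
    rw [insertNth_eq_add, torusForm_add_circle]
  have h2 : ∀ y : Fin 2 → ℝ, torusForm g ((2 : Fin 3).insertNth 1 y) =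
      torusForm g ((2 : Fin 3).insertNth 0 y) := fun y ↦ by
    rw [insertNth_eq_add, torusForm_add_one]
  have hrem : ((0 : Fin 3).removeNth fun j ↦ (Pi.single j 1 : Fin 3 → ℝ)) =
      ![Pi.single 1 1, Pi.single 2 1] := by
    ext i
    fin_cases i <;> rfl
  have h3 : ∀ y : Fin 2 → ℝ, torusForm g ((0 : Fin 3).insertNth 1 y)
      ![Pi.single 1 1, Pi.single 2 1] = 0 := fun y ↦ by
    rw [torusForm_apply]
    simp [fderiv_torusHomotopy_one_of_one]
  simp only [Matrix.cons_val_zero, Matrix.cons_val_one, Matrix.cons_val, h1, h2, hrem, h3,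
    sub_self, add_zero, mul_zero, integral_zero, zero_sub, neg_eq_zero] at key
  have hpos : 0 < ∫ y in Set.Icc (![0, 0, 0] ∘ (0 : Fin 3).succAbove)
      (![1, 2 * Real.pi, 1] ∘ (0 : Fin 3).succAbove),
      -torusForm g ((0 : Fin 3).insertNth 0 y) ![Pi.single 1 1, Pi.single 2 1] := by
    have hneg : ∀ y : Fin 2 → ℝ, 0 <
        -torusForm g ((0 : Fin 3).insertNth 0 y) ![Pi.single 1 1, Pi.single 2 1] := fun y ↦
      neg_pos.2 (torusForm_neg g (by simp))
    rw [setIntegral_pos_iff_support_of_nonneg_ae]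
    · have : Function.support (fun y : Fin 2 → ℝ ↦
          -torusForm g ((0 : Fin 3).insertNth 0 y) ![Pi.single 1 1, Pi.single 2 1]) = Set.univ :=
        Set.eq_univ_of_forall fun y ↦ (hneg y).ne'
      rw [this, Set.univ_inter, Real.volume_Icc_pi]
      simp [Fin.prod_univ_two, Real.pi_pos]
    · exact Eventually.of_forall fun y ↦ (hneg y).le
    · refine Continuous.integrableOn_Icc ?_
      have hc : Continuous fun x ↦ torusForm g x ![Pi.single 1 1, Pi.single 2 1] :=
        (ContinuousAlternatingMap.apply ℝ (Fin 3 → ℝ) ℝ _).continuous.comp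
          (differentiable_torusForm g).continuous
      exact (hc.comp (continuous_const.finInsertNth _ continuous_id)).neg
  rw [integral_neg] at hpos
  simp only [Fin.val_zero, pow_zero, one_mul] at key
  linarith

/-! ### Comparison of a hermitian metric with `⟨u, v⟩ / ‖p‖²` -/

lemma continuousOn_hermLift_self (g : HermitianMetric (HopfSurface l)) :
    ContinuousOn (fun q : C2 × C2 ↦ hermLift g q.1 q.2 q.2) {q | q.1 ≠ 0} := by
  have h : ContinuousOn (fun q : C2 × C2 ↦ hermLift g q.1) {q | q.1 ≠ 0} :=
    (contDiffOn_hermLift g).continuousOn.comp continuousOn_fst fun q hq ↦ hq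
  exact (h.clm_apply continuousOn_snd).clm_apply continuousOn_snd

lemma hermLift_smul_real (g : HermitianMetric (HopfSurface l)) (p u : C2) (a : ℝ) :
    hermLift g p (a • u) (a • u) = a ^ 2 * hermLift g p u u := by
  rw [map_smul, map_smul, smul_apply, smul_eq_mul, smul_eq_mul]
  ring

lemma exists_hermLift_bounds_shell (g : HermitianMetric (HopfSurface l)) :
    ∃ m M : ℝ, 0 < m ∧ 0 < M ∧ ∀ p ∈ hopfShell l, ∀ u : C2,
      m * ‖u‖ ^ 2 ≤ hermLift g p u u ∧ hermLift g p u u ≤ M * ‖u‖ ^ 2 := by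
  let K : Set (C2 × C2) := hopfShell l ×ˢ Metric.sphere (0 : C2) 1
  have hK : IsCompact K := (isCompact_hopfShell l).prod (isCompact_sphere _ _)
  have hKne : K.Nonempty := by
    refine ⟨(EuclideanSpace.single 0 1, EuclideanSpace.single 0 1), ⟨?_, ?_⟩, ?_⟩
    · simp
    · simpa using l.2.le
    · simp
  have hc : ContinuousOn (fun q : C2 × C2 ↦ hermLift g q.1 q.2 q.2) K :=
    (continuousOn_hermLift_self g).mono fun q hq ↦ ne_zero_of_mem_hopfShell hq.1
  have hpos : ∀ q ∈ K, 0 < hermLift g q.1 q.2 q.2 := fun q hq ↦ by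
    refine hermLift_pos g (ne_zero_of_mem_hopfShell hq.1) fun h ↦ ?_
    have := hq.2
    simp [h] at this
  obtain ⟨a, ha, hmin⟩ := hK.exists_isMinOn hKne hc
  obtain ⟨b, hb, hmax⟩ := hK.exists_isMaxOn hKne hc
  rw [isMinOn_iff] at hmin
  rw [isMaxOn_iff] at hmax
  refine ⟨hermLift g a.1 a.2 a.2, hermLift g b.1 b.2 b.2, hpos a ha, hpos b hb, fun p hp u ↦ ?_⟩
  rcases eq_or_ne u 0 with rfl | hu
  · simp
  have hu' : 0 < ‖u‖ := norm_pos_iff.2 hu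
  have hmem : (p, ‖u‖⁻¹ • u) ∈ K := by
    refine ⟨hp, ?_⟩
    rw [mem_sphere_zero_iff_norm, norm_smul, norm_inv, norm_norm, inv_mul_cancel₀ hu'.ne']
  have hmul : hermLift g p u u = hermLift g p (‖u‖⁻¹ • u) (‖u‖⁻¹ • u) * ‖u‖ ^ 2 := by
    rw [hermLift_smul_real]
    field_simp
  rw [hmul]
  exact ⟨mul_le_mul_of_nonneg_right (hmin _ hmem) (by positivity),
    mul_le_mul_of_nonneg_right (hmax _ hmem) (by positivity)⟩

lemma exists_hermLift_bounds (g : HermitianMetric (HopfSurface l)) :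
    ∃ m M : ℝ, 0 < m ∧ 0 < M ∧ ∀ p : C2, p ≠ 0 → ∀ u : C2,
      m * (‖u‖ ^ 2 / ‖p‖ ^ 2) ≤ hermLift g p u u ∧
        hermLift g p u u ≤ M * (‖u‖ ^ 2 / ‖p‖ ^ 2) := by
  obtain ⟨m, M, hm, hM, h⟩ := exists_hermLift_bounds_shell g
  have hl : 0 < ‖l.1‖ := one_pos.trans l.2
  refine ⟨m, M * ‖l.1‖ ^ 2, hm, by positivity, fun p hp u ↦ ?_⟩
  obtain ⟨n, hn⟩ := exists_zpow_norm_mem_Icc l hp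
  have hp' : 0 < ‖p‖ := norm_pos_iff.2 hp
  have hz : 0 < ‖l.1‖ ^ n := zpow_pos hl n
  obtain ⟨h1, h2⟩ := h _ hn (l.1 ^ n • u)
  rw [hermLift_zpow_smul g n hp] at h1 h2
  have h3 : ‖u‖ ^ 2 / ‖p‖ ^ 2 = ‖l.1 ^ n • u‖ ^ 2 / ‖l.1 ^ n • p‖ ^ 2 := by
    rw [norm_smul, norm_smul, norm_zpow]
    field_simp
  rw [h3]
  obtain ⟨hn1, hn2⟩ := hn
  constructor
  · refine le_trans (mul_le_mul_of_nonneg_left ?_ hm.le) h1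
    exact div_le_self (by positivity) (one_le_pow₀ hn1)
  · refine h2.trans ?_
    rw [mul_assoc]
    refine mul_le_mul_of_nonneg_left ?_ hM.le
    rw [← mul_div_assoc, le_div_iff₀ (by positivity), mul_comm]
    exact mul_le_mul_of_nonneg_right (pow_le_pow_left₀ (norm_nonneg _) hn2 2) (by positivity)

/-! ### The integrand of the order function -/

lemma realInner_I_left (u v : C2) : realInner u (Complex.I • v) = -realInner (Complex.I • u) v := by
  have h := realInner_smul Complex.I u (Complex.I • v)
  rw [smul_smul, Complex.I_mul_I, neg_one_smul, map_neg, Complex.norm_I, one_pow, one_mul] at h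
  exact h.symm

lemma dc_norm_sq_apply (z : C2) (v : Fin 1 → C2) :
    dc (fun z ↦ ‖z‖ ^ 2) z v = (2 * Real.pi)⁻¹ * realInner (Complex.I • z) (v 0) := by
  have h : fderiv ℝ (fun z : C2 ↦ ‖z‖ ^ 2) z = 2 • innerSL ℝ z := fderiv_norm_sq_apply z
  have h2 : dc (fun z ↦ ‖z‖ ^ 2) z v =
      -(1 / (4 * Real.pi)) * (2 * realInner z (Complex.I • v 0)) := by
    rw [dc, h]
    simp [mulI]
    rfl
  rw [h2, realInner_I_left]
  have := Real.pi_pos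
  field_simp
  norm_num

lemma alphaForm_apply (z : C2) (v : Fin 2 → C2) :
    alphaForm z v = Real.pi⁻¹ * realInner (Complex.I • v 0) (v 1) := by
  have hlin : ∀ w : C2, HasFDerivAt
      (fun z : C2 ↦ (2 * Real.pi)⁻¹ * realInner (Complex.I • z) w)
      ((2 * Real.pi)⁻¹ • (realInner.flip w).comp mulI) z := fun w ↦
    ((2 * Real.pi)⁻¹ • (realInner.flip w).comp mulI).hasFDerivAt
  have hd : DifferentiableAt ℝ (dc fun z ↦ ‖z‖ ^ 2) z := by
    refine differentiableAt_alternating fun v ↦ ?_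
    simp only [dc_norm_sq_apply]
    exact (hlin _).differentiableAt
  rw [alphaForm, extDeriv_apply hd, Fin.sum_univ_two]
  simp only [dc_norm_sq_apply]
  rw [(hlin _).fderiv, (hlin _).fderiv]
  have h0 : (0 : Fin 2).removeNth v 0 = v 1 := rfl
  have h1 : (1 : Fin 2).removeNth v 0 = v 0 := rfl
  rw [h0, h1]
  have h2 : ∀ a b : C2, ((2 * Real.pi)⁻¹ • (realInner.flip a).comp mulI) b =
      (2 * Real.pi)⁻¹ * realInner (Complex.I • b) a := fun _ _ ↦ rfl
  rw [h2, h2]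
  have h3 : realInner (Complex.I • v 1) (v 0) = -realInner (Complex.I • v 0) (v 1) := by
    rw [realInner_symm, realInner_I_left]
  rw [h3]
  have := Real.pi_pos
  simp
  field_simp
  ring

lemma realInner_eq (u v : C2) :
    realInner u v = (v 0 * (starRingEnd ℂ) (u 0)).re + (v 1 * (starRingEnd ℂ) (u 1)).re := by
  have : realInner u v = (inner ℂ u v).re := rfl
  rw [this, PiLp.inner_apply, Fin.sum_univ_two]
  simp

lemma wedgeApply_alphaForm (η : C2 [⋀^Fin 2]→L[ℝ] ℝ) (z : C2) :
    wedgeApply η (alphaForm z) stdFrame = Real.pi⁻¹ *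
      (η ![EuclideanSpace.single 0 1, Complex.I • EuclideanSpace.single 0 1] +
        η ![EuclideanSpace.single 1 1, Complex.I • EuclideanSpace.single 1 1]) := by
  have e0 : (EuclideanSpace.single 0 1 : C2) = !₂[1, 0] := by
    ext i
    fin_cases i <;> simp
  have e1 : (EuclideanSpace.single 1 1 : C2) = !₂[0, 1] := by
    ext i
    fin_cases i <;> simp
  have i0 : Complex.I • (!₂[1, 0] : C2) = !₂[Complex.I, 0] := by
    ext i
    fin_cases i <;> simp
  have i1 : Complex.I • (!₂[0, 1] : C2) = !₂[0, Complex.I] := by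
    ext i
    fin_cases i <;> simp
  rw [e0, e1, i0, i1]
  simp [wedgeApply, alphaForm_apply, realInner_eq, stdFrame]
  ring

lemma pullbackForm_comp {F : C2 → C2} {z : C2} (hF : DifferentiableAt ℂ F z) (h0 : F z ≠ 0)
    (g : HermitianMetric (HopfSurface l)) (u : C2) :
    pullbackForm g.form (fun z ↦ hopfProj l (F z)) z ![u, Complex.I • u] =
      hermLift g (F z) (fderiv ℂ F z u) (fderiv ℂ F z u) := by
  have h1 : MDifferentiableAt 𝓘(ℝ, C2) 𝓘(ℝ, C2) (hopfProj l) (F z) :=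
    (contMDiffAt_hopfProj (𝕜 := ℝ) (n := ∞) l h0).mdifferentiableAt (by simp)
  have h2 : HasMFDerivAt 𝓘(ℝ, C2) 𝓘(ℝ, C2) F z
      ((fderiv ℂ F z).restrictScalars ℝ : C2 →L[ℝ] C2) :=
    (hF.hasFDerivAt.restrictScalars ℝ).hasMFDerivAt
  have h3 := (HasMFDerivAt.comp z h1.hasMFDerivAt h2).mfderiv
  have h4 : pullbackForm g.form (fun z ↦ hopfProj l (F z)) z ![u, Complex.I • u] =
      formLift g (F z) ![fderiv ℂ F z u, fderiv ℂ F z (Complex.I • u)] := by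
    have key : ∀ a b c d : C2, a = c → b = d →
        g.inner (hopfProj l (F z)) (tangentJ _ a) b =
          g.inner (hopfProj l (F z)) (tangentJ _ c) d := by
      rintro a b _ _ rfl rfl
      rfl
    exact key _ _ _ _ (congrArg (fun L : C2 →L[ℝ] C2 ↦ L u) h3)
      (congrArg (fun L : C2 →L[ℝ] C2 ↦ L (Complex.I • u)) h3)
  rw [h4, formLift_apply g h0]
  simp only [Matrix.cons_val_zero, Matrix.cons_val_one]
  rw [map_smul (fderiv ℂ F z), hermLift_I g h0]

/-- The integrand of the order function of `hopfProj ∘ F`. -/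
lemma wedgeApply_pullbackForm_comp {F : C2 → C2} {z : C2} (hF : DifferentiableAt ℂ F z)
    (h0 : F z ≠ 0) (g : HermitianMetric (HopfSurface l)) :
    wedgeApply (pullbackForm g.form (fun z ↦ hopfProj l (F z)) z) (alphaForm z) stdFrame =
      Real.pi⁻¹ *
        (hermLift g (F z) (fderiv ℂ F z (EuclideanSpace.single 0 1))
            (fderiv ℂ F z (EuclideanSpace.single 0 1)) +
          hermLift g (F z) (fderiv ℂ F z (EuclideanSpace.single 1 1))
            (fderiv ℂ F z (EuclideanSpace.single 1 1))) := by
  rw [wedgeApply_alphaForm, pullbackForm_comp hF h0, pullbackForm_comp hF h0]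

/-! ### An entire function of order `1 / 2` -/

/-- The entire function `z ↦ cosh √z`. -/
def coshSqrt (z : ℂ) : ℂ := ∑' n : ℕ, z ^ n / ((2 * n).factorial : ℂ)

lemma coshSqrt_sq (s : ℂ) : coshSqrt (s ^ 2) = Complex.cosh s := by
  rw [coshSqrt, ← (Complex.hasSum_cosh s).tsum_eq]
  simp only [pow_mul]

lemma differentiable_coshSqrt : Differentiable ℂ coshSqrt := by
  intro z
  have hsum : Summable fun n : ℕ ↦ (‖z‖ + 1) ^ n / (n.factorial : ℝ) :=
    Real.summable_pow_div_factorial _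
  have h := Complex.differentiableOn_tsum_of_summable_norm (U := Metric.ball (0 : ℂ) (‖z‖ + 1))
    (F := fun (n : ℕ) (w : ℂ) ↦ w ^ n / ((2 * n).factorial : ℂ)) hsum
    (fun n ↦ ((differentiable_id.pow n).div_const _).differentiableOn) Metric.isOpen_ball ?_
  · exact h.differentiableAt (Metric.isOpen_ball.mem_nhds (by simp))
  · intro n w hw
    rw [mem_ball_zero_iff] at hw
    rw [norm_div, norm_pow, Complex.norm_natCast]
    have h1 : (n.factorial : ℝ) ≤ ((2 * n).factorial : ℝ) := by
      exact_mod_cast Nat.factorial_le (by omega)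
    have h2 : (0 : ℝ) < n.factorial := by exact_mod_cast n.factorial_pos
    gcongr

lemma deriv_coshSqrt_sq (z : ℂ) : 4 * z * deriv coshSqrt z ^ 2 = coshSqrt z ^ 2 - 1 := by
  obtain ⟨s, rfl⟩ : ∃ s : ℂ, s ^ 2 = z := ⟨z ^ (2⁻¹ : ℂ), by simp⟩
  have h1 : HasDerivAt (fun w : ℂ ↦ coshSqrt (w ^ 2)) (deriv coshSqrt (s ^ 2) * (2 * s)) s := by
    have := (differentiable_coshSqrt (s ^ 2)).hasDerivAt.comp s (hasDerivAt_pow 2 s)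
    simpa [Function.comp_def] using this
  simp only [coshSqrt_sq] at h1
  have h2 := h1.unique (Complex.hasDerivAt_cosh s)
  have h3 := Complex.cosh_sq s
  rw [coshSqrt_sq, h3, ← h2]
  ring

lemma coshSqrt_zero : coshSqrt 0 = 1 := by
  simpa using coshSqrt_sq 0

lemma norm_deriv_coshSqrt_sq_le (z : ℂ) :
    4 * ‖z‖ * ‖deriv coshSqrt z‖ ^ 2 ≤ ‖coshSqrt z‖ ^ 2 + 1 := by
  have h := congrArg norm (deriv_coshSqrt_sq z)
  rw [norm_mul, norm_mul, norm_pow] at h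
  have h2 := norm_sub_le (coshSqrt z ^ 2) 1
  rw [norm_pow, norm_one] at h2
  have h4 : ‖(4 : ℂ)‖ = 4 := by norm_num
  rw [h4] at h
  linarith

lemma le_norm_deriv_coshSqrt_sq (z : ℂ) :
    ‖coshSqrt z‖ ^ 2 - 1 ≤ 4 * ‖z‖ * ‖deriv coshSqrt z‖ ^ 2 := by
  have h := congrArg norm (deriv_coshSqrt_sq z)
  rw [norm_mul, norm_mul, norm_pow] at h
  have h2 := norm_sub_norm_le (coshSqrt z ^ 2) 1
  rw [norm_pow, norm_one] at h2
  have h4 : ‖(4 : ℂ)‖ = 4 := by norm_num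
  rw [h4] at h
  linarith

/-- `cosh √z` grows faster than any power of `Re z` on the right half-plane. -/
lemma pow_le_norm_coshSqrt {z : ℂ} (hz : 0 ≤ z.re) :
    z.re ^ 3 / 1440 - 1 / 2 ≤ ‖coshSqrt z‖ := by
  obtain ⟨s, rfl⟩ : ∃ s : ℂ, s ^ 2 = z := ⟨z ^ (2⁻¹ : ℂ), by simp⟩
  rw [coshSqrt_sq]
  have key : ∀ s : ℂ, 0 ≤ s.re → 0 ≤ (s ^ 2).re →
      (s ^ 2).re ^ 3 / 1440 - 1 / 2 ≤ ‖Complex.cosh s‖ := by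
    intro s hs hs2
    have h1 : (s ^ 2).re ≤ s.re ^ 2 := by
      rw [sq, Complex.mul_re]
      nlinarith [mul_self_nonneg s.im]
    have h2 : (s ^ 2).re ^ 3 ≤ s.re ^ 6 := by
      calc (s ^ 2).re ^ 3 ≤ (s.re ^ 2) ^ 3 := pow_le_pow_left₀ hs2 h1 3
        _ = s.re ^ 6 := by ring
    have h3 : s.re ^ 6 / 720 ≤ Real.exp s.re := by
      have := Real.pow_div_factorial_le_exp s.re hs 6
      simpa [Nat.factorial] using this
    have h4 : ‖Complex.exp s‖ - ‖Complex.exp (-s)‖ ≤ ‖Complex.exp s + Complex.exp (-s)‖ := by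
      have := norm_sub_norm_le (Complex.exp s) (-Complex.exp (-s))
      simpa using this
    have h5 : ‖Complex.exp (-s)‖ ≤ 1 := by
      rw [Complex.norm_exp, Complex.neg_re, Real.exp_le_one_iff]
      linarith
    rw [Complex.norm_exp] at h4
    rw [Complex.cosh, norm_div]
    have : ‖(2 : ℂ)‖ = 2 := by norm_num
    rw [this]
    linarith
  rcases le_total 0 s.re with hs | hs
  · exact key s hs hz
  · have := key (-s) (by simpa using hs) (by simpa using hz)
    simpa using this

/-! ### A map `ℂ² → ℂ² ∖ {0}` -/

/-- The vector `(a, b)` of `ℂ²`. -/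
def vec (a b : ℂ) : C2 := a • EuclideanSpace.single 0 1 + b • EuclideanSpace.single 1 1

lemma norm_vec_sq (a b : ℂ) : ‖vec a b‖ ^ 2 = ‖a‖ ^ 2 + ‖b‖ ^ 2 := by
  rw [EuclideanSpace.norm_sq_eq, Fin.sum_univ_two]
  simp [vec]

lemma vec_eq_zero {a b : ℂ} : vec a b = 0 ↔ a = 0 ∧ b = 0 := by
  rw [← norm_eq_zero, ← sq_eq_zero_iff, norm_vec_sq,
    add_eq_zero_iff_of_nonneg (by positivity) (by positivity)]
  simp

lemma vec_coord (z : C2) : vec (z 0) (z 1) = z := by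
  ext i
  fin_cases i <;> simp [vec]

/-- The map `(x, y) ↦ (cosh √x + x y, x)`. -/
def hopfCurve (z : C2) : C2 := vec (coshSqrt (z 0) + z 0 * z 1) (z 0)

lemma hopfCurve_ne_zero (z : C2) : hopfCurve z ≠ 0 := by
  intro h
  obtain ⟨h1, h2⟩ := vec_eq_zero.1 h
  rw [h2] at h1
  simp [coshSqrt_zero] at h1

lemma hasFDerivAt_coord (i : Fin 2) (z : C2) :
    HasFDerivAt (fun z : C2 ↦ z i) (EuclideanSpace.proj i : C2 →L[ℂ] ℂ) z :=
  (EuclideanSpace.proj i : C2 →L[ℂ] ℂ).hasFDerivAt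

lemma contDiff_hopfCurve : ContDiff ℂ ω hopfCurve := by
  have h : ∀ i : Fin 2, ContDiff ℂ ω (fun z : C2 ↦ z i) := fun i ↦
    (EuclideanSpace.proj i : C2 →L[ℂ] ℂ).contDiff
  have hc : ContDiff ℂ ω coshSqrt := differentiable_coshSqrt.contDiff
  exact (((hc.comp (h 0)).add ((h 0).mul (h 1))).smul contDiff_const).add
    ((h 0).smul contDiff_const)

lemma differentiable_hopfCurve : Differentiable ℂ hopfCurve :=
  contDiff_hopfCurve.differentiable (by simp)

lemma fderiv_hopfCurve (z u : C2) : fderiv ℂ hopfCurve z u =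
    vec (deriv coshSqrt (z 0) * u 0 + (z 0 * u 1 + z 1 * u 0)) (u 0) := by
  have h0 := hasFDerivAt_coord 0 z
  have h1 := hasFDerivAt_coord 1 z
  have hc : HasFDerivAt (fun z : C2 ↦ coshSqrt (z 0))
      (deriv coshSqrt (z 0) • (EuclideanSpace.proj 0 : C2 →L[ℂ] ℂ)) z :=
    HasDerivAt.comp_hasFDerivAt (h₂ := coshSqrt) z
      (differentiable_coshSqrt (z 0)).hasDerivAt h0
  have h := ((hc.add (h0.mul h1)).smul_const (EuclideanSpace.single 0 1 : C2)).add
    (h0.smul_const (EuclideanSpace.single 1 1 : C2))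
  have h' : HasFDerivAt hopfCurve _ z := h
  rw [h'.fderiv]
  simp [vec]

lemma norm_fderiv_hopfCurve_zero (z : C2) :
    ‖fderiv ℂ hopfCurve z (EuclideanSpace.single 0 1)‖ ^ 2 =
      ‖deriv coshSqrt (z 0) + z 1‖ ^ 2 + 1 := by
  rw [fderiv_hopfCurve, norm_vec_sq]
  simp

lemma norm_fderiv_hopfCurve_one (z : C2) :
    ‖fderiv ℂ hopfCurve z (EuclideanSpace.single 1 1)‖ ^ 2 = ‖z 0‖ ^ 2 := by
  rw [fderiv_hopfCurve, norm_vec_sq]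
  simp

lemma fderiv_hopfCurve_injective {z : C2} (hz : z 0 ≠ 0) :
    Function.Injective (fderiv ℂ hopfCurve z) := by
  rw [injective_iff_map_eq_zero]
  intro u hu
  rw [fderiv_hopfCurve, vec_eq_zero] at hu
  obtain ⟨h1, h2⟩ := hu
  rw [h2] at h1
  have h3 : u 1 = 0 := by simpa [hz] using h1
  rw [← vec_coord u, h2, h3, vec_eq_zero]
  exact ⟨rfl, rfl⟩

/-- The map `ℂ² → S` of order one. -/
def hopfMap (l : HopfMultiplier) (z : C2) : HopfSurface l := hopfProj l (hopfCurve z)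

lemma contMDiff_hopfMap (l : HopfMultiplier) :
    ContMDiff 𝓘(ℂ, C2) 𝓘(ℂ, C2) ω (hopfMap l) := fun z ↦
  ContMDiffAt.comp z (contMDiffAt_hopfProj (𝕜 := ℂ) (n := ω) l (hopfCurve_ne_zero z))
    contDiff_hopfCurve.contMDiff.contMDiffAt

lemma isDifferentiablyNondegenerate_hopfMap (l : HopfMultiplier) :
    IsDifferentiablyNondegenerate (hopfMap l) := by
  have hcont : Continuous fun z : C2 ↦ z 0 := (EuclideanSpace.proj 0 : C2 →L[ℂ] ℂ).continuous
  refine ⟨{z | z 0 ≠ 0}, isOpen_ne.preimage hcont, ?_, fun z hz ↦ ?_⟩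
  · have hopen : IsOpenMap fun z : C2 ↦ z 0 :=
      (EuclideanSpace.proj 0 : C2 →L[ℂ] ℂ).isOpenMap fun a ↦ ⟨vec a 0, by simp [vec]⟩
    exact (dense_compl_singleton (0 : ℂ)).preimage hopen
  · obtain ⟨a, -, ha⟩ := hasMFDerivAt_hopfProj (𝕜 := ℂ) l (hopfCurve_ne_zero z)
    have h2 : HasMFDerivAt 𝓘(ℂ, C2) 𝓘(ℂ, C2) hopfCurve z (fderiv ℂ hopfCurve z) :=
      (differentiable_hopfCurve z).hasFDerivAt.hasMFDerivAt
    have h3 := (HasMFDerivAt.comp z ha h2).mfderiv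
    have hinj : Function.Injective (mfderiv 𝓘(ℂ, C2) 𝓘(ℂ, C2) (hopfMap l) z : C2 → C2) := by
      intro u v huv
      have e : ∀ w : C2, (mfderiv 𝓘(ℂ, C2) 𝓘(ℂ, C2) (hopfMap l) z w : C2) =
          ((a : ℂˣ) : ℂ) • fderiv ℂ hopfCurve z w := fun w ↦
        congrArg (fun L : C2 →L[ℂ] C2 ↦ L w) h3
      have huv' := (e u).symm.trans (huv.trans (e v))
      exact fderiv_hopfCurve_injective hz (smul_right_injective C2 (a : ℂˣ).ne_zero huv')
    refine (LinearMap.finrank_range_of_inj hinj).trans ?_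
    exact finrank_euclideanSpace_fin

/-! ### Integrals on `ℂ` and `ℂ²` -/

section Integrals

open MeasureTheory Set
open scoped ENNReal

/-- The real-linear isomorphism `(x, y) ↦ (x, y)` from `ℂ × ℂ` to `ℂ²`. -/
def vecEquiv : (ℂ × ℂ) ≃L[ℝ] C2 :=
  LinearEquiv.toContinuousLinearEquiv
    { toFun := fun q ↦ vec q.1 q.2
      invFun := fun z ↦ (z 0, z 1)
      map_add' := fun p q ↦ by
        ext i
        fin_cases i <;> simp [vec]
      map_smul' := fun c q ↦ by
        ext i
        fin_cases i <;> simp [vec]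
      left_inv := fun q ↦ by simp [vec]
      right_inv := fun z ↦ vec_coord z }

/-- Fubini's theorem on `ℂ²`, up to the normalization of the volume. -/
lemma exists_lintegral_eq_mul : ∃ κ : ℝ, 0 < κ ∧ ∀ φ : C2 → ℝ≥0∞, Measurable φ →
    ∫⁻ z, φ z = ENNReal.ofReal κ * ∫⁻ x : ℂ, ∫⁻ y : ℂ, φ (vec x y) := by
  let ν : Measure C2 := Measure.map vecEquiv ((volume : Measure ℂ).prod (volume : Measure ℂ))
  have : ν.IsAddHaarMeasure := vecEquiv.isAddHaarMeasure_map _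
  let c := Measure.addHaarScalarFactor (volume : Measure C2) ν
  have hc : (volume : Measure C2) = c • ν := Measure.isAddLeftInvariant_eq_smul _ _
  refine ⟨c, Measure.addHaarScalarFactor_pos_of_isAddHaarMeasure _ _, fun φ hφ ↦ ?_⟩
  rw [hc, lintegral_smul_measure, lintegral_map hφ vecEquiv.continuous.measurable,
    lintegral_prod (fun q ↦ φ (vecEquiv q))
      (hφ.comp vecEquiv.continuous.measurable).aemeasurable, ENNReal.ofReal_coe_nnreal]
  rfl

lemma setLIntegral_ball_radial (h : ℝ → ℝ≥0∞) (hh : Measurable h) (R : ℝ) :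
    ∫⁻ w in Metric.ball (0 : ℂ) R, h ‖w‖ =
      (∫⁻ r in Ioo 0 R, ENNReal.ofReal r * h r) * ENNReal.ofReal (2 * Real.pi) := by
  rw [← lintegral_indicator Metric.isOpen_ball.measurableSet,
    ← Complex.lintegral_comp_polarCoord_symm]
  have h1 : ∀ p ∈ polarCoord.target, ENNReal.ofReal p.1 •
      (Metric.ball (0 : ℂ) R).indicator (fun w ↦ h ‖w‖) (Complex.polarCoord.symm p) =
      (Iio R).indicator (fun r ↦ ENNReal.ofReal r * h r) p.1 * 1 := by
    intro p hp
    have hp0 : 0 < p.1 := hp.1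
    have hn : ‖Complex.polarCoord.symm p‖ = p.1 := by
      rw [Complex.norm_polarCoord_symm, abs_of_pos hp0]
    by_cases hR : p.1 < R
    · rw [indicator_of_mem (by rw [mem_ball_zero_iff, hn]; exact hR),
        indicator_of_mem (by simpa using hR), hn, smul_eq_mul, mul_one]
    · rw [indicator_of_notMem (by rw [mem_ball_zero_iff, hn]; exact hR),
        indicator_of_notMem (by simpa using hR), smul_zero, zero_mul]
  rw [setLIntegral_congr_fun polarCoord.open_target.measurableSet h1]
  have hm : Measurable fun r : ℝ ↦ ENNReal.ofReal r * h r := ENNReal.measurable_ofReal.mul hh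
  have h2 : polarCoord.target = Ioi (0 : ℝ) ×ˢ Ioo (-Real.pi) Real.pi := rfl
  rw [h2, Measure.volume_eq_prod, ← Measure.prod_restrict,
    lintegral_prod_mul (hm.indicator measurableSet_Iio).aemeasurable aemeasurable_const]
  congr 1
  · rw [lintegral_indicator measurableSet_Iio, Measure.restrict_restrict measurableSet_Iio,
      inter_comm, Ioi_inter_Iio]
  · rw [lintegral_one, Measure.restrict_apply_univ, Real.volume_Ioo]
    congr 1
    ring

lemma setLIntegral_ball_inv_norm_le {R : ℝ} (hR : 0 ≤ R) :
    ∫⁻ w in Metric.ball (0 : ℂ) R, ENNReal.ofReal ‖w‖⁻¹ ≤ ENNReal.ofReal (2 * Real.pi * R) := by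
  rw [setLIntegral_ball_radial (fun r ↦ ENNReal.ofReal r⁻¹) (by fun_prop), mul_comm (2 * Real.pi),
    ENNReal.ofReal_mul hR]
  gcongr
  calc ∫⁻ r in Ioo 0 R, ENNReal.ofReal r * ENNReal.ofReal r⁻¹
      ≤ ∫⁻ r in Ioo 0 R, 1 := by
        refine setLIntegral_mono measurable_const fun r hr ↦ ?_
        rw [← ENNReal.ofReal_mul hr.1.le, mul_inv_cancel₀ hr.1.ne', ENNReal.ofReal_one]
    _ = ENNReal.ofReal R := by
        rw [lintegral_one, Measure.restrict_apply_univ, Real.volume_Ioo, sub_zero]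

lemma setLIntegral_ball_inv_one_add_sq_le {R : ℝ} (hR : 0 ≤ R) :
    ∫⁻ w in Metric.ball (0 : ℂ) R, ENNReal.ofReal (1 + ‖w‖ ^ 2)⁻¹ ≤
      ENNReal.ofReal (Real.pi * Real.log (1 + R ^ 2)) := by
  have hint : ∫ r in (0 : ℝ)..R, r * (1 + r ^ 2)⁻¹ = Real.log (1 + R ^ 2) / 2 := by
    have hd : ∀ r ∈ uIcc (0 : ℝ) R,
        HasDerivAt (fun r : ℝ ↦ Real.log (1 + r ^ 2) / 2) (r * (1 + r ^ 2)⁻¹) r := by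
      intro r _
      have h0 : (1 + r ^ 2 : ℝ) ≠ 0 := by positivity
      have h1 : HasDerivAt (fun r : ℝ ↦ 1 + r ^ 2) (2 * r) r := by
        simpa using (hasDerivAt_pow 2 r).const_add 1
      refine ((h1.log h0).div_const 2).congr_deriv ?_
      field_simp
    rw [intervalIntegral.integral_eq_sub_of_hasDerivAt hd]
    · simp
    · refine Continuous.intervalIntegrable ?_ _ _
      refine continuous_id.mul (Continuous.inv₀ (by fun_prop) fun r ↦ ?_)
      positivity
  have hcont : Continuous fun r : ℝ ↦ r * (1 + r ^ 2)⁻¹ :=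
    continuous_id.mul (Continuous.inv₀ (by fun_prop) fun r ↦ by positivity)
  rw [setLIntegral_ball_radial (fun r ↦ ENNReal.ofReal (1 + r ^ 2)⁻¹) (by fun_prop)]
  have h1 : ∫⁻ r in Ioo 0 R, ENNReal.ofReal r * ENNReal.ofReal (1 + r ^ 2)⁻¹ =
      ENNReal.ofReal (Real.log (1 + R ^ 2) / 2) := by
    rw [← hint, intervalIntegral.integral_of_le hR, integral_Ioc_eq_integral_Ioo,
      ofReal_integral_eq_lintegral_ofReal]
    · refine setLIntegral_congr_fun measurableSet_Ioo fun r hr ↦ ?_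
      rw [← ENNReal.ofReal_mul hr.1.le]
    · exact (hcont.integrableOn_Icc (a := 0) (b := R)).mono_set Ioo_subset_Icc_self
    · refine (ae_restrict_iff' measurableSet_Ioo).2 (Eventually.of_forall fun r hr ↦ ?_)
      have := hr.1
      simp only [Pi.zero_apply]
      positivity
  rw [h1, ← ENNReal.ofReal_mul' (by positivity)]
  apply le_of_eq
  congr 1
  ring

/-- A bound that is uniform in the translation `q`. -/
lemma setLIntegral_ball_inv_one_add_sq_translate_le {R : ℝ} (hR : 0 ≤ R) (q : ℂ) :
    ∫⁻ w in Metric.ball (0 : ℂ) R, ENNReal.ofReal (1 + ‖q + w‖ ^ 2)⁻¹ ≤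
      ENNReal.ofReal (Real.pi * (Real.log (1 + R ^ 2) + 1)) := by
  let k : ℂ → ℝ≥0∞ := fun w ↦ ENNReal.ofReal (1 + ‖w‖ ^ 2)⁻¹
  have hk : Measurable k := by fun_prop
  have hb : ∀ w, k w ≤ (Metric.ball (0 : ℂ) R).indicator k w + ENNReal.ofReal (1 + R ^ 2)⁻¹ := by
    intro w
    by_cases hw : w ∈ Metric.ball (0 : ℂ) R
    · rw [indicator_of_mem hw]
      exact le_self_add
    · rw [indicator_of_notMem hw, zero_add]
      have : R ≤ ‖w‖ := by simpa using hw
      refine ENNReal.ofReal_le_ofReal ?_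
      gcongr
  calc ∫⁻ w in Metric.ball (0 : ℂ) R, k (q + w)
      ≤ ∫⁻ w in Metric.ball (0 : ℂ) R,
        ((Metric.ball (0 : ℂ) R).indicator k (q + w) + ENNReal.ofReal (1 + R ^ 2)⁻¹) :=
        lintegral_mono fun w ↦ hb (q + w)
    _ = (∫⁻ w in Metric.ball (0 : ℂ) R, (Metric.ball (0 : ℂ) R).indicator k (q + w)) +
        ENNReal.ofReal (1 + R ^ 2)⁻¹ * volume (Metric.ball (0 : ℂ) R) := by
        rw [lintegral_add_right _ measurable_const, setLIntegral_const]
    _ ≤ (∫⁻ w, (Metric.ball (0 : ℂ) R).indicator k (q + w)) +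
        ENNReal.ofReal (1 + R ^ 2)⁻¹ * volume (Metric.ball (0 : ℂ) R) := by
        gcongr
        exact Measure.restrict_le_self
    _ ≤ ENNReal.ofReal (Real.pi * Real.log (1 + R ^ 2)) + ENNReal.ofReal Real.pi := by
        gcongr
        · rw [lintegral_add_left_eq_self (fun w ↦ (Metric.ball (0 : ℂ) R).indicator k w) q,
            lintegral_indicator Metric.isOpen_ball.measurableSet]
          exact setLIntegral_ball_inv_one_add_sq_le hR
        · rw [Complex.volume_ball, ← ENNReal.ofReal_pow hR, ← ENNReal.ofReal_coe_nnreal,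
            ← ENNReal.ofReal_mul (by positivity), ← ENNReal.ofReal_mul (by positivity)]
          refine ENNReal.ofReal_le_ofReal ?_
          rw [NNReal.coe_real_pi, ← mul_assoc]
          refine mul_le_of_le_one_left Real.pi_pos.le ?_
          rw [inv_mul_le_iff₀ (by positivity)]
          linarith
    _ = ENNReal.ofReal (Real.pi * (Real.log (1 + R ^ 2) + 1)) := by
        rw [← ENNReal.ofReal_add _ Real.pi_pos.le]
        · congr 1
          ring
        · exact mul_nonneg Real.pi_pos.le (Real.log_nonneg (by nlinarith [sq_nonneg R]))

end Integrals

/-! ### The energy density of the map `hopfCurve` -/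

/-- The density `(‖∂₁F‖² + ‖∂₂F‖²) / ‖F‖²` of `F = hopfCurve` at the point `(x, y)`. -/
def density (x y : ℂ) : ℝ :=
  (‖deriv coshSqrt x + y‖ ^ 2 + 1 + ‖x‖ ^ 2) / (‖coshSqrt x + x * y‖ ^ 2 + ‖x‖ ^ 2)

lemma density_denom_pos (x y : ℂ) : 0 < ‖coshSqrt x + x * y‖ ^ 2 + ‖x‖ ^ 2 := by
  rcases eq_or_ne x 0 with rfl | hx
  · simp [coshSqrt_zero]
  · have := norm_pos_iff.2 hx
    positivity

lemma density_nonneg (x y : ℂ) : 0 ≤ density x y := by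
  unfold density
  positivity

lemma continuous_density : Continuous fun q : ℂ × ℂ ↦ density q.1 q.2 := by
  have h1 : Continuous coshSqrt := differentiable_coshSqrt.continuous
  have h2 : Continuous (deriv coshSqrt) :=
    (differentiable_coshSqrt.contDiff (n := 1)).continuous_deriv le_rfl
  unfold density
  refine Continuous.div₀ (by fun_prop) (by fun_prop) fun q ↦
    ne_of_gt (density_denom_pos q.1 q.2)

/-- The denominator of the density in terms of `q = cosh √x / x`. -/
lemma density_eq {x : ℂ} (hx : x ≠ 0) (y : ℂ) :
    density x y = (‖deriv coshSqrt x + y‖ ^ 2 + 1 + ‖x‖ ^ 2) / ‖x‖ ^ 2 *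
      (1 + ‖coshSqrt x / x + y‖ ^ 2)⁻¹ := by
  have h : coshSqrt x + x * y = x * (coshSqrt x / x + y) := by
    field_simp
  have hx' : 0 < ‖x‖ := norm_pos_iff.2 hx
  rw [density, h, norm_mul]
  field_simp
  ring

lemma norm_add_sq_le (a b : ℂ) : ‖a + b‖ ^ 2 ≤ 2 * ‖a‖ ^ 2 + 2 * ‖b‖ ^ 2 := by
  have h := norm_add_le a b
  nlinarith [sq_nonneg (‖a‖ - ‖b‖), norm_nonneg (a + b), norm_nonneg a, norm_nonneg b]

lemma density_le_of_one_le {t : ℝ} {x y : ℂ} (hx : 1 ≤ ‖x‖) (hxt : ‖x‖ < t) (hy : ‖y‖ < t) :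
    density x y ≤ ‖x‖⁻¹ * (1 + 6 * t ^ 2 * (1 + ‖coshSqrt x / x + y‖ ^ 2)⁻¹) := by
  have hx0 : x ≠ 0 := norm_pos_iff.1 (one_pos.trans_le hx)
  have hxp : 0 < ‖x‖ := one_pos.trans_le hx
  rw [density_eq hx0]
  have hq : ‖coshSqrt x‖ = ‖x‖ * ‖coshSqrt x / x‖ := by
    rw [norm_div]
    field_simp
  have h1 := norm_deriv_coshSqrt_sq_le x
  rw [hq] at h1
  have h2 := norm_add_sq_le (deriv coshSqrt x) y
  have h3 : ‖coshSqrt x / x‖ ^ 2 ≤ 2 * ‖coshSqrt x / x + y‖ ^ 2 + 2 * ‖y‖ ^ 2 := by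
    have := norm_add_sq_le (coshSqrt x / x + y) (-y)
    simpa using this
  set Q := ‖coshSqrt x / x + y‖ ^ 2 with hQ
  set q := ‖coshSqrt x / x‖
  set X := ‖x‖
  have hQ0 : 0 ≤ Q := by positivity
  have hy2 : ‖y‖ ^ 2 ≤ t ^ 2 := pow_le_pow_left₀ (norm_nonneg _) hy.le 2
  have h4 : ‖deriv coshSqrt x‖ ^ 2 * 2 ≤ X * (Q + t ^ 2) + 1 / 2 := by
    have h5 : 4 * X * ‖deriv coshSqrt x‖ ^ 2 ≤ 2 * X * (X * (Q + t ^ 2) + 1 / 2) := by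
      have : X ^ 2 * q ^ 2 ≤ X ^ 2 * (2 * Q + 2 * t ^ 2) := by gcongr; linarith
      nlinarith
    nlinarith
  have h6 : ‖deriv coshSqrt x + y‖ ^ 2 + 1 + X ^ 2 ≤ X * (1 + Q + 6 * t ^ 2) := by
    nlinarith
  calc (‖deriv coshSqrt x + y‖ ^ 2 + 1 + X ^ 2) / X ^ 2 * (1 + Q)⁻¹
      ≤ (X * (1 + Q + 6 * t ^ 2)) / X ^ 2 * (1 + Q)⁻¹ := by gcongr
    _ = X⁻¹ * (1 + 6 * t ^ 2 * (1 + Q)⁻¹) := by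
        field_simp

lemma exists_density_le_of_le_one : ∃ C M : ℝ, 0 < C ∧ 1 ≤ M ∧ ∀ t : ℝ, 1 ≤ t → ∀ x y : ℂ,
    ‖x‖ ≤ 1 → ‖y‖ < t →
    (1 / (M * t) ≤ ‖x‖ → density x y ≤
      C * t ^ 3 * ‖x‖⁻¹ * (1 + ‖coshSqrt x / x + y‖ ^ 2)⁻¹) ∧
    (‖x‖ < 1 / (M * t) → density x y ≤ C * t ^ 2) := by
  have hc : Continuous coshSqrt := differentiable_coshSqrt.continuous
  have hc' : Continuous (deriv coshSqrt) :=
    (differentiable_coshSqrt.contDiff (n := 1)).continuous_deriv le_rfl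
  obtain ⟨A, hA⟩ := (isCompact_closedBall (0 : ℂ) 1).exists_bound_of_continuousOn hc'.continuousOn
  have hA0 : 0 ≤ A := (norm_nonneg _).trans (hA 0 (by simp))
  obtain ⟨δ, hδ, hball⟩ := Metric.continuousAt_iff.1 (hc.continuousAt (x := 0)) (1 / 4)
    (by norm_num)
  let M : ℝ := max 4 (1 / δ)
  have hM4 : 4 ≤ M := le_max_left _ _
  have hMδ : 1 / δ ≤ M := le_max_right _ _
  have hM0 : 0 < M := by linarith
  refine ⟨(2 * A ^ 2 + 4) * (M + 4), M, by positivity, by linarith, fun t ht x y hx hy ↦ ?_⟩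
  have ht0 : 0 < t := by linarith
  have hnum : ‖deriv coshSqrt x + y‖ ^ 2 + 1 + ‖x‖ ^ 2 ≤ (2 * A ^ 2 + 4) * t ^ 2 := by
    have h1 := norm_add_sq_le (deriv coshSqrt x) y
    have h2 : ‖deriv coshSqrt x‖ ^ 2 ≤ A ^ 2 :=
      pow_le_pow_left₀ (norm_nonneg _) (hA x (by simpa using hx)) 2
    have h3 : ‖y‖ ^ 2 ≤ t ^ 2 := pow_le_pow_left₀ (norm_nonneg _) hy.le 2
    have h4 : ‖x‖ ^ 2 ≤ 1 := pow_le_one₀ (norm_nonneg _) hx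
    have h5 : 1 ≤ t ^ 2 := one_le_pow₀ ht
    nlinarith [sq_nonneg A]
  constructor
  · intro hxM
    have hxp : 0 < ‖x‖ := lt_of_lt_of_le (by positivity) hxM
    rw [density_eq (norm_pos_iff.1 hxp)]
    refine mul_le_mul_of_nonneg_right ?_ (by positivity)
    have h1 : ‖x‖⁻¹ ≤ M * t := by
      rw [inv_le_comm₀ hxp (by positivity)]
      simpa using hxM
    calc (‖deriv coshSqrt x + y‖ ^ 2 + 1 + ‖x‖ ^ 2) / ‖x‖ ^ 2
        ≤ (2 * A ^ 2 + 4) * t ^ 2 / ‖x‖ ^ 2 := by gcongr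
      _ = (2 * A ^ 2 + 4) * t ^ 2 * ‖x‖⁻¹ * ‖x‖⁻¹ := by field_simp
      _ ≤ (2 * A ^ 2 + 4) * t ^ 2 * (M * t) * ‖x‖⁻¹ := by gcongr
      _ ≤ (2 * A ^ 2 + 4) * t ^ 2 * ((M + 4) * t) * ‖x‖⁻¹ := by gcongr; linarith
      _ = (2 * A ^ 2 + 4) * (M + 4) * t ^ 3 * ‖x‖⁻¹ := by ring
  · intro hxM
    rw [lt_div_iff₀ (by positivity)] at hxM
    have hxδ : ‖x‖ < δ := by
      have h1 : 1 ≤ M * δ := by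
        rw [div_le_iff₀ hδ] at hMδ
        exact hMδ
      by_contra! h
      have h2 : M * δ ≤ ‖x‖ * (M * t) := by
        calc M * δ ≤ M * ‖x‖ := by gcongr
          _ ≤ M * ‖x‖ * t := le_mul_of_one_le_right (by positivity) ht
          _ = ‖x‖ * (M * t) := by ring
      linarith
    have ha : ‖coshSqrt x - 1‖ < 1 / 4 := by
      have := hball (x := x) (by simpa using hxδ)
      rwa [coshSqrt_zero, dist_eq_norm] at this
    have hxy : ‖x * y‖ ≤ 1 / 4 := by
      rw [norm_mul]
      have : ‖x‖ * ‖y‖ ≤ ‖x‖ * t := by gcongr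
      nlinarith [norm_nonneg x, mul_nonneg (norm_nonneg x) ht0.le]
    have hden : 1 / 2 ≤ ‖coshSqrt x + x * y‖ := by
      have h1 : (1 : ℂ) = (coshSqrt x + x * y) - (coshSqrt x - 1) - x * y := by ring
      have h2 := norm_sub_le ((coshSqrt x + x * y) - (coshSqrt x - 1)) (x * y)
      have h3 := norm_sub_le (coshSqrt x + x * y) (coshSqrt x - 1)
      rw [← h1, norm_one] at h2
      linarith
    rw [density, div_le_iff₀ (density_denom_pos x y)]
    have h1 : 1 / 4 ≤ ‖coshSqrt x + x * y‖ ^ 2 + ‖x‖ ^ 2 := by nlinarith [sq_nonneg ‖x‖]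
    calc ‖deriv coshSqrt x + y‖ ^ 2 + 1 + ‖x‖ ^ 2
        ≤ (2 * A ^ 2 + 4) * t ^ 2 := hnum
      _ = (2 * A ^ 2 + 4) * 4 * t ^ 2 * (1 / 4) := by ring
      _ ≤ (2 * A ^ 2 + 4) * (M + 4) * t ^ 2 * (‖coshSqrt x + x * y‖ ^ 2 + ‖x‖ ^ 2) := by
        gcongr
        linarith

lemma norm_le_of_mem_ball {t : ℝ} (ht : 0 < t) {x : ℂ}
    (hx : x ∈ Metric.ball (3 * t / 8 : ℂ) (t / 16)) : ‖x‖ ≤ t / 2 := by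
  rw [mem_ball_iff_norm] at hx
  have h1 : ‖(3 * t / 8 : ℂ)‖ = 3 * t / 8 := by
    have : (3 * t / 8 : ℂ) = ((3 * t / 8 : ℝ) : ℂ) := by push_cast; ring
    rw [this, Complex.norm_real, Real.norm_of_nonneg (by positivity)]
  have h2 := norm_sub_norm_le x (3 * t / 8 : ℂ)
  linarith

/-- Where `cosh √x` dominates, the density is of size `1 / ‖x‖`. -/
lemma le_density {t : ℝ} (ht : 10 ^ 8 ≤ t) {x y : ℂ} (hx : x ∈ Metric.ball (3 * t / 8 : ℂ) (t / 16))
    (hy : ‖y‖ < t / 2) : 1 / (400 * t) ≤ density x y := by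
  have ht0 : 0 < t := by linarith
  have hre : 5 * t / 16 ≤ x.re := by
    rw [mem_ball_iff_norm] at hx
    have h1 := (Complex.abs_re_le_norm _).trans hx.le
    have h2 : (x - (3 * t / 8 : ℂ)).re = x.re - 3 * t / 8 := by
      rw [Complex.sub_re]
      congr 1
      have : (3 * t / 8 : ℂ) = ((3 * t / 8 : ℝ) : ℂ) := by push_cast; ring
      rw [this, Complex.ofReal_re]
    rw [h2, abs_le] at h1
    linarith [h1.1]
  have hxt : ‖x‖ ≤ t / 2 := norm_le_of_mem_ball ht0 hx
  have hxp : 0 < ‖x‖ := by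
    have := Complex.re_le_norm x
    linarith
  have ha : 16 * t ^ 2 ≤ ‖coshSqrt x‖ := by
    have h1 := pow_le_norm_coshSqrt (z := x) (by linarith)
    have h2 : (5 * t / 16) ^ 3 ≤ x.re ^ 3 := pow_le_pow_left₀ (by positivity) hre 3
    have h3 : 10 ^ 8 * t ^ 2 ≤ t ^ 3 := by nlinarith [sq_nonneg t]
    nlinarith [sq_nonneg t]
  have hd := le_norm_deriv_coshSqrt_sq x
  set a := ‖coshSqrt x‖
  set d := ‖deriv coshSqrt x‖ with hdd
  have ha1 : 1 ≤ a := by nlinarith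
  have hd2 : a ^ 2 ≤ 4 * t * d ^ 2 := by
    have : 4 * ‖x‖ * d ^ 2 ≤ 4 * (t / 2) * d ^ 2 := by gcongr
    nlinarith
  have hd3 : t ≤ d := by
    by_contra! h
    have h1 : d ^ 2 ≤ t ^ 2 := pow_le_pow_left₀ (norm_nonneg _) h.le 2
    have h2 : (16 * t ^ 2) ^ 2 ≤ a ^ 2 := pow_le_pow_left₀ (by positivity) ha 2
    have h3 : 4 * t * d ^ 2 ≤ 4 * t * t ^ 2 := by gcongr
    have h4 : t ^ 3 ≤ t ^ 4 := pow_le_pow_right₀ (by linarith) (by norm_num)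
    have h5 : 0 < t ^ 4 := by positivity
    nlinarith
  have hnum : (d / 2) ^ 2 ≤ ‖deriv coshSqrt x + y‖ ^ 2 := by
    refine pow_le_pow_left₀ (by positivity) ?_ 2
    have := norm_sub_norm_le (deriv coshSqrt x) (-y)
    rw [norm_neg, sub_neg_eq_add] at this
    linarith
  have hxy : ‖x * y‖ ≤ a := by
    rw [norm_mul]
    have : ‖x‖ * ‖y‖ ≤ (t / 2) * (t / 2) := by gcongr
    nlinarith
  have hden : ‖coshSqrt x + x * y‖ ^ 2 + ‖x‖ ^ 2 ≤ 5 * a ^ 2 := by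
    have h1 : ‖coshSqrt x + x * y‖ ≤ 2 * a := (norm_add_le _ _).trans (by linarith)
    have h2 : ‖x‖ ≤ a := by nlinarith
    have h3 := pow_le_pow_left₀ (norm_nonneg _) h1 2
    have h4 := pow_le_pow_left₀ (norm_nonneg _) h2 2
    nlinarith
  rw [density, le_div_iff₀ (density_denom_pos x y), one_div_mul_eq_div, div_le_iff₀ (by positivity)]
  nlinarith [sq_nonneg ‖x‖, sq_nonneg d, mul_nonneg ht0.le (sq_nonneg d)]

attribute [irreducible] density

/-! ### Growth of the energy of `hopfCurve` -/

section Energy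

open MeasureTheory Set
open scoped ENNReal

lemma volume_ball_complex (a : ℂ) {r : ℝ} (hr : 0 ≤ r) :
    volume (Metric.ball a r) = ENNReal.ofReal (Real.pi * r ^ 2) := by
  rw [Complex.volume_ball, ← ENNReal.ofReal_pow hr, ← ENNReal.ofReal_coe_nnreal,
    ← ENNReal.ofReal_mul (by positivity), NNReal.coe_real_pi, mul_comm]

lemma setLIntegral_density_le_of_one_le {t : ℝ} {x : ℂ} (hx : 1 ≤ ‖x‖) (hxt : ‖x‖ < t) :
    ∫⁻ y in Metric.ball (0 : ℂ) t, ENNReal.ofReal (density x y) ≤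
      ENNReal.ofReal ‖x‖⁻¹ *
        ENNReal.ofReal (7 * Real.pi * t ^ 2 * (1 + Real.log (1 + t ^ 2))) := by
  have ht0 : 0 ≤ t := (norm_nonneg x).trans hxt.le
  have hL : 0 ≤ Real.log (1 + t ^ 2) := Real.log_nonneg (by nlinarith [sq_nonneg t])
  have hpi := Real.pi_pos
  let k : ℂ → ℝ≥0∞ := fun y ↦ ENNReal.ofReal (1 + ‖coshSqrt x / x + y‖ ^ 2)⁻¹
  have hk : Measurable k := by fun_prop
  calc ∫⁻ y in Metric.ball (0 : ℂ) t, ENNReal.ofReal (density x y)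
      ≤ ∫⁻ y in Metric.ball (0 : ℂ) t,
        ENNReal.ofReal ‖x‖⁻¹ * (1 + ENNReal.ofReal (6 * t ^ 2) * k y) := by
        refine setLIntegral_mono (by fun_prop) fun y hy ↦ ?_
        rw [← ENNReal.ofReal_mul (by positivity), ← ENNReal.ofReal_one,
          ← ENNReal.ofReal_add zero_le_one (by positivity), ← ENNReal.ofReal_mul (by positivity)]
        exact ENNReal.ofReal_le_ofReal (density_le_of_one_le hx hxt (by simpa using hy))
    _ = ENNReal.ofReal ‖x‖⁻¹ * (volume (Metric.ball (0 : ℂ) t) +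
        ENNReal.ofReal (6 * t ^ 2) * ∫⁻ y in Metric.ball (0 : ℂ) t, k y) := by
        rw [lintegral_const_mul _ (by fun_prop), lintegral_add_left measurable_const,
          setLIntegral_const, one_mul, lintegral_const_mul _ hk]
    _ ≤ ENNReal.ofReal ‖x‖⁻¹ * (ENNReal.ofReal (Real.pi * t ^ 2) + ENNReal.ofReal (6 * t ^ 2) *
        ENNReal.ofReal (Real.pi * (Real.log (1 + t ^ 2) + 1))) := by
        rw [volume_ball_complex _ ht0]
        gcongr
        exact setLIntegral_ball_inv_one_add_sq_translate_le ht0 _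
    _ ≤ _ := by
        gcongr
        rw [← ENNReal.ofReal_mul (by positivity), ← ENNReal.ofReal_add (by positivity)
          (by positivity)]
        refine ENNReal.ofReal_le_ofReal ?_
        nlinarith [mul_nonneg (mul_nonneg hpi.le (sq_nonneg t)) hL]

lemma setLIntegral_le_of_le_translate {t c : ℝ} (ht : 0 ≤ t) (hc : 0 ≤ c) (q : ℂ) {φ : ℂ → ℝ}
    (h : ∀ y, ‖y‖ < t → φ y ≤ c * (1 + ‖q + y‖ ^ 2)⁻¹) :
    ∫⁻ y in Metric.ball (0 : ℂ) t, ENNReal.ofReal (φ y) ≤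
      ENNReal.ofReal (c * (Real.pi * (Real.log (1 + t ^ 2) + 1))) := by
  calc ∫⁻ y in Metric.ball (0 : ℂ) t, ENNReal.ofReal (φ y)
      ≤ ∫⁻ y in Metric.ball (0 : ℂ) t,
        ENNReal.ofReal c * ENNReal.ofReal (1 + ‖q + y‖ ^ 2)⁻¹ := by
        refine setLIntegral_mono (by fun_prop) fun y hy ↦ ?_
        rw [← ENNReal.ofReal_mul hc]
        exact ENNReal.ofReal_le_ofReal (h y (by simpa using hy))
    _ ≤ _ := by
        rw [lintegral_const_mul _ (by fun_prop), ENNReal.ofReal_mul hc]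
        gcongr
        exact setLIntegral_ball_inv_one_add_sq_translate_le ht _

lemma exists_lintegral_density_le : ∃ C : ℝ, 0 < C ∧ ∀ t : ℝ, 1 ≤ t →
    ∫⁻ x in Metric.ball (0 : ℂ) t, ∫⁻ y in Metric.ball (0 : ℂ) t, ENNReal.ofReal (density x y) ≤
      ENNReal.ofReal (C * t ^ 3 * (1 + Real.log (1 + t ^ 2))) := by
  obtain ⟨C, M, hC, hM, hD⟩ := exists_density_le_of_le_one
  have hpi := Real.pi_pos
  refine ⟨Real.pi ^ 2 * (14 + 5 * C), by positivity, fun t ht ↦ ?_⟩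
  have ht0 : 0 < t := by linarith
  have hM0 : 0 < M := by linarith
  have hL : 0 ≤ Real.log (1 + t ^ 2) := Real.log_nonneg (by nlinarith [sq_nonneg t])
  set L := Real.log (1 + t ^ 2) with hLdef
  let s : ℝ := 1 / (M * t)
  have hs0 : 0 < s := by positivity
  let B₁ : ℝ≥0∞ := ENNReal.ofReal (7 * Real.pi * t ^ 2 * (1 + L))
  let B₂ : ℝ≥0∞ := ENNReal.ofReal (C * t ^ 3 * (Real.pi * (L + 1)))
  let B₃ : ℝ≥0∞ := ENNReal.ofReal (C * t ^ 2 * (Real.pi * t ^ 2))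
  let n : ℂ → ℝ≥0∞ := fun x ↦ ENNReal.ofReal ‖x‖⁻¹
  have hn : Measurable n := by fun_prop
  have hG : ∀ x ∈ Metric.ball (0 : ℂ) t,
      ∫⁻ y in Metric.ball (0 : ℂ) t, ENNReal.ofReal (density x y) ≤
        n x * B₁ + ((Metric.ball (0 : ℂ) 2).indicator (fun x ↦ n x * B₂) x +
          (Metric.ball (0 : ℂ) s).indicator (fun _ ↦ B₃) x) := by
    intro x hx
    rw [mem_ball_zero_iff] at hx
    rcases le_total 1 ‖x‖ with h1 | h1
    · exact (setLIntegral_density_le_of_one_le h1 hx).trans le_self_add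
    refine le_trans ?_ le_add_self
    rcases le_or_gt s ‖x‖ with h2 | h2
    · refine le_trans ?_ le_self_add
      rw [indicator_of_mem (by rw [mem_ball_zero_iff]; linarith), mul_comm,
        ← ENNReal.ofReal_mul (by positivity)]
      refine (setLIntegral_le_of_le_translate ht0.le (by positivity) _
        fun y hy ↦ (hD t ht x y h1 hy).1 h2).trans (le_of_eq ?_)
      congr 1
      ring
    · refine le_trans ?_ le_add_self
      rw [indicator_of_mem (by rwa [mem_ball_zero_iff])]
      calc ∫⁻ y in Metric.ball (0 : ℂ) t, ENNReal.ofReal (density x y)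
          ≤ ∫⁻ y in Metric.ball (0 : ℂ) t, ENNReal.ofReal (C * t ^ 2) :=
            setLIntegral_mono measurable_const fun y hy ↦
              ENNReal.ofReal_le_ofReal ((hD t ht x y h1 (by simpa using hy)).2 h2)
        _ = B₃ := by
            rw [setLIntegral_const, volume_ball_complex _ ht0.le,
              ← ENNReal.ofReal_mul (by positivity)]
  have hm2 : MeasurableSet (Metric.ball (0 : ℂ) 2) := Metric.isOpen_ball.measurableSet
  have hms : MeasurableSet (Metric.ball (0 : ℂ) s) := Metric.isOpen_ball.measurableSet
  calc ∫⁻ x in Metric.ball (0 : ℂ) t, ∫⁻ y in Metric.ball (0 : ℂ) t, ENNReal.ofReal (density x y)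
      ≤ ∫⁻ x in Metric.ball (0 : ℂ) t,
        (n x * B₁ + ((Metric.ball (0 : ℂ) 2).indicator (fun x ↦ n x * B₂) x +
          (Metric.ball (0 : ℂ) s).indicator (fun _ ↦ B₃) x)) := by
        refine setLIntegral_mono ?_ hG
        exact (hn.mul_const _).add (((hn.mul_const _).indicator hm2).add
          (measurable_const.indicator hms))
    _ = (∫⁻ x in Metric.ball (0 : ℂ) t, n x * B₁) +
        ((∫⁻ x in Metric.ball (0 : ℂ) t, (Metric.ball (0 : ℂ) 2).indicator (fun x ↦ n x * B₂) x) +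
        ∫⁻ x in Metric.ball (0 : ℂ) t, (Metric.ball (0 : ℂ) s).indicator (fun _ ↦ B₃) x) := by
        rw [lintegral_add_left (hn.mul_const _),
          lintegral_add_left ((hn.mul_const _).indicator hm2)]
    _ ≤ (∫⁻ x in Metric.ball (0 : ℂ) t, n x * B₁) +
        ((∫⁻ x, (Metric.ball (0 : ℂ) 2).indicator (fun x ↦ n x * B₂) x) +
        ∫⁻ x, (Metric.ball (0 : ℂ) s).indicator (fun _ ↦ B₃) x) := by
        gcongr <;> exact Measure.restrict_le_self
    _ ≤ ENNReal.ofReal (2 * Real.pi * t) * B₁ + (ENNReal.ofReal (2 * Real.pi * 2) * B₂ +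
        B₃ * ENNReal.ofReal (Real.pi * s ^ 2)) := by
        rw [lintegral_indicator hm2, lintegral_indicator hms, lintegral_mul_const _ hn,
          lintegral_mul_const _ hn, setLIntegral_const, volume_ball_complex _ hs0.le]
        gcongr
        · exact setLIntegral_ball_inv_norm_le ht0.le
        · exact setLIntegral_ball_inv_norm_le zero_le_two
    _ ≤ _ := by
        rw [← ENNReal.ofReal_mul (by positivity), ← ENNReal.ofReal_mul (by positivity),
          ← ENNReal.ofReal_mul (by positivity), ← ENNReal.ofReal_add (by positivity)
          (by positivity), ← ENNReal.ofReal_add (by positivity) (by positivity)]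
        refine ENNReal.ofReal_le_ofReal ?_
        have hst : s ^ 2 * t ^ 2 ≤ 1 := by
          rw [← mul_pow]
          refine pow_le_one₀ (by positivity) ?_
          have : s * t = 1 / M := by
            simp only [s]
            field_simp
          rw [this, div_le_one hM0]
          exact hM
        have h3 : t ^ 2 ≤ t ^ 3 * (1 + L) := by
          have : t ^ 2 ≤ t ^ 3 := pow_le_pow_right₀ ht (by norm_num)
          nlinarith [mul_nonneg (pow_pos ht0 3).le hL]
        have h4 : C * t ^ 2 * (Real.pi * t ^ 2) * (Real.pi * s ^ 2) ≤
            C * Real.pi ^ 2 * (t ^ 3 * (1 + L)) := by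
          calc C * t ^ 2 * (Real.pi * t ^ 2) * (Real.pi * s ^ 2)
              = C * Real.pi ^ 2 * t ^ 2 * (s ^ 2 * t ^ 2) := by ring
            _ ≤ C * Real.pi ^ 2 * t ^ 2 * 1 := by gcongr
            _ ≤ C * Real.pi ^ 2 * (t ^ 3 * (1 + L)) := by
              rw [mul_one]
              gcongr
        linarith

lemma continuous_density_coord : Continuous fun z : C2 ↦ density (z 0) (z 1) := by
  have h : Continuous fun z : C2 ↦ ((z 0, z 1) : ℂ × ℂ) := by fun_prop
  exact continuous_density.comp h

lemma integrableOn_ball_of_continuous {φ : C2 → ℝ} (h : Continuous φ) (t : ℝ) :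
    IntegrableOn φ (Metric.ball 0 t) :=
  (h.continuousOn.integrableOn_compact (isCompact_closedBall (0 : C2) t)).mono_set
    Metric.ball_subset_closedBall

/-- The energy of `hopfCurve` in the ball of radius `t`. -/
def energy (t : ℝ) : ℝ := ∫ z in Metric.ball (0 : C2) t, density (z 0) (z 1)

lemma ofReal_energy (t : ℝ) : ENNReal.ofReal (energy t) =
    ∫⁻ z in Metric.ball (0 : C2) t, ENNReal.ofReal (density (z 0) (z 1)) :=
  ofReal_integral_eq_lintegral_ofReal (integrableOn_ball_of_continuous continuous_density_coord t)
    (Eventually.of_forall fun _ ↦ density_nonneg _ _)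

lemma vec_apply_zero (x y : ℂ) : vec x y 0 = x := by simp [vec]

lemma vec_apply_one (x y : ℂ) : vec x y 1 = y := by simp [vec]

lemma measurable_density_coord :
    Measurable fun z : C2 ↦ ENNReal.ofReal (density (z 0) (z 1)) :=
  (ENNReal.continuous_ofReal.comp continuous_density_coord).measurable

lemma measurable_indicator_density (t : ℝ) : Measurable
    ((Metric.ball (0 : C2) t).indicator fun z ↦ ENNReal.ofReal (density (z 0) (z 1))) :=
  measurable_density_coord.indicator Metric.isOpen_ball.measurableSet

lemma exists_energy_le : ∃ C : ℝ, 0 < C ∧ ∀ t : ℝ, 1 ≤ t →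
    energy t ≤ C * t ^ 3 * (1 + Real.log (1 + t ^ 2)) := by
  obtain ⟨κ, hκ, hfub⟩ := exists_lintegral_eq_mul
  obtain ⟨C, hC, h⟩ := exists_lintegral_density_le
  refine ⟨κ * C, by positivity, fun t ht ↦ ?_⟩
  have hL : 0 ≤ Real.log (1 + t ^ 2) := Real.log_nonneg (by nlinarith [sq_nonneg t])
  have ht0 : 0 < t := by linarith
  rw [← ENNReal.ofReal_le_ofReal_iff (by positivity), ofReal_energy,
    ← lintegral_indicator Metric.isOpen_ball.measurableSet, hfub _ (measurable_indicator_density t),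
    mul_assoc, mul_assoc, ENNReal.ofReal_mul hκ.le]
  gcongr
  rw [← mul_assoc]
  refine le_trans ?_ (h t ht)
  rw [← lintegral_indicator Metric.isOpen_ball.measurableSet]
  refine lintegral_mono fun x ↦ ?_
  have hmem : ∀ y, vec x y ∈ Metric.ball (0 : C2) t →
      x ∈ Metric.ball (0 : ℂ) t ∧ y ∈ Metric.ball (0 : ℂ) t := by
    intro y hy
    rw [mem_ball_zero_iff] at hy
    have h1 := norm_vec_sq x y
    have h2 := pow_lt_pow_left₀ hy (norm_nonneg _) two_ne_zero
    constructor <;> rw [mem_ball_zero_iff] <;>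
      refine lt_of_pow_lt_pow_left₀ 2 ht0.le ?_ <;> nlinarith [sq_nonneg ‖x‖, sq_nonneg ‖y‖]
  by_cases hx : x ∈ Metric.ball (0 : ℂ) t
  · rw [indicator_of_mem hx, ← lintegral_indicator Metric.isOpen_ball.measurableSet]
    refine lintegral_mono fun y ↦ ?_
    by_cases hy : vec x y ∈ Metric.ball (0 : C2) t
    · rw [indicator_of_mem hy, indicator_of_mem (hmem y hy).2, vec_apply_zero, vec_apply_one]
    · rw [indicator_of_notMem hy]
      exact zero_le
  · rw [indicator_of_notMem hx]
    refine le_of_eq (lintegral_eq_zero_of_ae_eq_zero (Eventually.of_forall fun y ↦ ?_))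
    exact indicator_of_notMem (fun hy ↦ hx (hmem y hy).1) _

lemma exists_le_energy : ∃ c t₀ : ℝ, 0 < c ∧ 1 ≤ t₀ ∧ ∀ t : ℝ, t₀ ≤ t → c * t ^ 3 ≤ energy t := by
  obtain ⟨κ, hκ, hfub⟩ := exists_lintegral_eq_mul
  have hpi := Real.pi_pos
  refine ⟨κ * (1 / 400 * (Real.pi * (1 / 2) ^ 2) * (Real.pi * (1 / 16) ^ 2)), 10 ^ 8,
    by positivity, by norm_num, fun t ht ↦ ?_⟩
  have ht0 : 0 < t := by linarith
  have hnn : 0 ≤ energy t := integral_nonneg fun _ ↦ density_nonneg _ _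
  rw [← ENNReal.ofReal_le_ofReal_iff hnn, ofReal_energy,
    ← lintegral_indicator Metric.isOpen_ball.measurableSet, hfub _ (measurable_indicator_density t),
    mul_assoc, ENNReal.ofReal_mul hκ.le]
  gcongr
  have h1 : ∀ x ∈ Metric.ball (3 * t / 8 : ℂ) (t / 16),
      ENNReal.ofReal (1 / (400 * t)) * ENNReal.ofReal (Real.pi * (t / 2) ^ 2) ≤
      ∫⁻ y, (Metric.ball (0 : C2) t).indicator (fun z ↦ ENNReal.ofReal (density (z 0) (z 1)))
        (vec x y) := by
    intro x hx
    rw [← volume_ball_complex 0 (by positivity), ← setLIntegral_const,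
      ← lintegral_indicator Metric.isOpen_ball.measurableSet]
    refine lintegral_mono fun y ↦ ?_
    by_cases hy : y ∈ Metric.ball (0 : ℂ) (t / 2)
    · have hy' : ‖y‖ < t / 2 := by simpa using hy
      have hmem : vec x y ∈ Metric.ball (0 : C2) t := by
        rw [mem_ball_zero_iff]
        refine lt_of_pow_lt_pow_left₀ 2 ht0.le ?_
        rw [norm_vec_sq]
        have h2 := pow_lt_pow_left₀ hy' (norm_nonneg _) two_ne_zero
        have h3 : ‖x‖ ^ 2 ≤ (t / 2) ^ 2 :=
          pow_le_pow_left₀ (norm_nonneg _) (norm_le_of_mem_ball ht0 hx) 2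
        nlinarith [sq_nonneg t]
      rw [indicator_of_mem hy, indicator_of_mem hmem, vec_apply_zero, vec_apply_one]
      exact ENNReal.ofReal_le_ofReal (le_density ht hx hy')
    · rw [indicator_of_notMem hy]
      exact zero_le
  calc ENNReal.ofReal (1 / 400 * (Real.pi * (1 / 2) ^ 2) * (Real.pi * (1 / 16) ^ 2) * t ^ 3)
      = ENNReal.ofReal (1 / (400 * t)) * ENNReal.ofReal (Real.pi * (t / 2) ^ 2) *
        ENNReal.ofReal (Real.pi * (t / 16) ^ 2) := by
        rw [← ENNReal.ofReal_mul (by positivity), ← ENNReal.ofReal_mul (by positivity)]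
        congr 1
        field_simp
    _ = ∫⁻ x in Metric.ball (3 * t / 8 : ℂ) (t / 16),
        ENNReal.ofReal (1 / (400 * t)) * ENNReal.ofReal (Real.pi * (t / 2) ^ 2) := by
        rw [setLIntegral_const, volume_ball_complex _ (by positivity)]
    _ ≤ ∫⁻ x in Metric.ball (3 * t / 8 : ℂ) (t / 16), ∫⁻ y, (Metric.ball (0 : C2) t).indicator
        (fun z ↦ ENNReal.ofReal (density (z 0) (z 1))) (vec x y) :=
        setLIntegral_mono' Metric.isOpen_ball.measurableSet h1
    _ ≤ _ := setLIntegral_le_lintegral _ _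

end Energy

/-! ### The order of `hopfMap` -/

section Order

open MeasureTheory Set

lemma tendsto_log_div_log_of_bounds {T : ℝ → ℝ} {c C : ℝ} (hc : 0 < c) (hC : 0 < C)
    (hlow : ∀ᶠ r in atTop, c * r ≤ T r)
    (hupp : ∀ᶠ r in atTop, T r ≤ C * r * (1 + 3 * Real.log r)) :
    Tendsto (fun r ↦ Real.log (T r) / Real.log r) atTop (𝓝 1) := by
  have hlog : Tendsto Real.log atTop atTop := Real.tendsto_log_atTop
  have h1 : ∀ a : ℝ, Tendsto (fun r ↦ a / Real.log r) atTop (𝓝 0) := fun a ↦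
    hlog.const_div_atTop a
  have h2 : Tendsto (fun r ↦ Real.log (1 + 3 * Real.log r) / Real.log r) atTop (𝓝 0) := by
    have h3 := (Real.tendsto_pow_log_div_mul_add_atTop (1 / 3) (-1 / 3) 1 (by norm_num)).comp
      (tendsto_atTop_add_const_left atTop 1 (hlog.const_mul_atTop (by norm_num : (0 : ℝ) < 3)))
    refine h3.congr fun r ↦ ?_
    simp only [Function.comp_apply, pow_one]
    congr 1
    ring
  have hlo : Tendsto (fun r ↦ Real.log c / Real.log r + 1) atTop (𝓝 1) := by
    simpa using (h1 (Real.log c)).add_const 1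
  have hup : Tendsto (fun r ↦ Real.log C / Real.log r + 1 +
      Real.log (1 + 3 * Real.log r) / Real.log r) atTop (𝓝 1) := by
    simpa using ((h1 (Real.log C)).add_const 1).add h2
  refine tendsto_of_tendsto_of_tendsto_of_le_of_le' hlo hup ?_ ?_
  · filter_upwards [hlow, eventually_gt_atTop 1] with r hr hr1
    have hl := Real.log_pos hr1
    have hr0 : 0 < r := by linarith
    rw [le_div_iff₀ hl, add_mul, div_mul_cancel₀ _ hl.ne', one_mul, ← Real.log_mul hc.ne' hr0.ne']
    exact Real.log_le_log (by positivity) hr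
  · filter_upwards [hlow, hupp, eventually_gt_atTop 1] with r hr hup hr1
    have hl := Real.log_pos hr1
    have hr0 : 0 < r := by linarith
    have hT : 0 < T r := lt_of_lt_of_le (by positivity) hr
    rw [div_le_iff₀ hl, add_mul, add_mul, div_mul_cancel₀ _ hl.ne', div_mul_cancel₀ _ hl.ne',
      one_mul, ← Real.log_mul hC.ne' hr0.ne', ← Real.log_mul (by positivity) (by positivity)]
    exact Real.log_le_log hT hup

/-- The growth of a logarithmically averaged increasing function of size `t³`, up to a logarithm. -/
lemma tendsto_log_integral_div_log {J : ℝ → ℝ} (hmono : Monotone J) {c C t₀ : ℝ} (hc : 0 < c)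
    (hC : 0 < C) (ht₀ : 1 ≤ t₀) (hnn : ∀ t, 0 ≤ J t) (hlow : ∀ t, t₀ ≤ t → c * t ^ 3 ≤ J t)
    (hupp : ∀ t, 1 ≤ t → J t ≤ C * t ^ 3 * (1 + Real.log (1 + t ^ 2))) :
    Tendsto (fun r ↦ Real.log (∫ t in (1 : ℝ)..r, (1 / t ^ 3) * J t) / Real.log r)
      atTop (𝓝 1) := by
  have hint : ∀ a b : ℝ, 1 ≤ a → 1 ≤ b →
      IntervalIntegrable (fun t ↦ (1 / t ^ 3) * J t) volume a b := by
    intro a b ha hb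
    refine IntervalIntegrable.continuousOn_mul hmono.intervalIntegrable ?_
    refine continuousOn_const.div (continuousOn_pow 3) fun t ht ↦ ?_
    have : 1 ≤ t := le_trans (le_min ha hb) ht.1
    positivity
  refine tendsto_log_div_log_of_bounds (c := c / 2) (C := C) (by positivity) hC ?_ ?_
  · filter_upwards [eventually_ge_atTop (2 * t₀)] with r hr
    have hr1 : t₀ ≤ r := by linarith
    rw [← intervalIntegral.integral_add_adjacent_intervals (hint 1 t₀ le_rfl ht₀)
      (hint t₀ r ht₀ (by linarith))]
    have h1 : 0 ≤ ∫ t in (1 : ℝ)..t₀, (1 / t ^ 3) * J t := by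
      refine intervalIntegral.integral_nonneg ht₀ fun t ht ↦ ?_
      have : 0 < t := one_pos.trans_le ht.1
      exact mul_nonneg (by positivity) (hnn t)
    have h2 : ∫ _ in t₀..r, c ≤ ∫ t in t₀..r, (1 / t ^ 3) * J t := by
      refine intervalIntegral.integral_mono_on hr1 intervalIntegrable_const
        (hint t₀ r ht₀ (by linarith)) fun t ht ↦ ?_
      have : 0 < t := one_pos.trans_le (ht₀.trans ht.1)
      rw [one_div_mul_eq_div, le_div_iff₀ (by positivity)]
      exact hlow t ht.1
    rw [intervalIntegral.integral_const, smul_eq_mul] at h2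
    nlinarith
  · filter_upwards [eventually_ge_atTop 2] with r hr
    have hr0 : 0 < r := by linarith
    have hr1 : 1 ≤ r := by linarith
    have hlr : 0 ≤ Real.log r := Real.log_nonneg hr1
    have h2 : ∫ t in (1 : ℝ)..r, (1 / t ^ 3) * J t ≤
        ∫ _ in (1 : ℝ)..r, C * (1 + 3 * Real.log r) := by
      refine intervalIntegral.integral_mono_on hr1 (hint 1 r le_rfl hr1)
        intervalIntegrable_const fun t ht ↦ ?_
      have ht0 : 0 < t := one_pos.trans_le ht.1
      rw [one_div_mul_eq_div, div_le_iff₀ (by positivity)]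
      refine (hupp t ht.1).trans ?_
      have h3 : Real.log (1 + t ^ 2) ≤ 3 * Real.log r := by
        have h4 : 3 * Real.log r = Real.log (r ^ 3) := by
          rw [Real.log_pow]
          norm_num
        rw [h4]
        refine Real.log_le_log (by positivity) ?_
        have : t ^ 2 ≤ r ^ 2 := pow_le_pow_left₀ ht0.le ht.2 2
        nlinarith [sq_nonneg r]
      calc C * t ^ 3 * (1 + Real.log (1 + t ^ 2)) ≤ C * t ^ 3 * (1 + 3 * Real.log r) := by gcongr
        _ = C * (1 + 3 * Real.log r) * t ^ 3 := by ring
    rw [intervalIntegral.integral_const, smul_eq_mul] at h2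
    have h5 : 0 ≤ C * (1 + 3 * Real.log r) := by positivity
    nlinarith

/-- The integrand of the order function of `hopfMap`. -/
def orderDensity (g : HermitianMetric (HopfSurface l)) (z : C2) : ℝ :=
  wedgeApply (pullbackForm g.form (hopfMap l) z) (alphaForm z) stdFrame

lemma orderDensity_eq (g : HermitianMetric (HopfSurface l)) (z : C2) :
    orderDensity g z = Real.pi⁻¹ *
        (hermLift g (hopfCurve z) (fderiv ℂ hopfCurve z (EuclideanSpace.single 0 1))
            (fderiv ℂ hopfCurve z (EuclideanSpace.single 0 1)) +
          hermLift g (hopfCurve z) (fderiv ℂ hopfCurve z (EuclideanSpace.single 1 1))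
            (fderiv ℂ hopfCurve z (EuclideanSpace.single 1 1))) :=
  wedgeApply_pullbackForm_comp (differentiable_hopfCurve z) (hopfCurve_ne_zero z) g

lemma continuous_orderDensity (g : HermitianMetric (HopfSurface l)) :
    Continuous (orderDensity g) := by
  have h : ∀ u : C2, Continuous fun z ↦
      hermLift g (hopfCurve z) (fderiv ℂ hopfCurve z u) (fderiv ℂ hopfCurve z u) := by
    intro u
    have h1 : Continuous fun z ↦ fderiv ℂ hopfCurve z u :=
      (contDiff_hopfCurve.continuous_fderiv (by simp)).clm_apply continuous_const
    have h2 : Continuous fun z ↦ ((hopfCurve z, fderiv ℂ hopfCurve z u) : C2 × C2) :=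
      contDiff_hopfCurve.continuous.prodMk h1
    exact (continuousOn_hermLift_self g).comp_continuous h2 hopfCurve_ne_zero
  have h3 : orderDensity g = _ := funext (orderDensity_eq g)
  rw [h3]
  exact continuous_const.mul ((h _).add (h _))

lemma density_coord_eq (z : C2) : density (z 0) (z 1) =
    ‖fderiv ℂ hopfCurve z (EuclideanSpace.single 0 1)‖ ^ 2 / ‖hopfCurve z‖ ^ 2 +
      ‖fderiv ℂ hopfCurve z (EuclideanSpace.single 1 1)‖ ^ 2 / ‖hopfCurve z‖ ^ 2 := by
  rw [norm_fderiv_hopfCurve_zero, norm_fderiv_hopfCurve_one, ← add_div, hopfCurve, norm_vec_sq,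
    density]

lemma exists_orderDensity_bounds (g : HermitianMetric (HopfSurface l)) :
    ∃ m M : ℝ, 0 < m ∧ 0 < M ∧ ∀ z : C2,
      m * density (z 0) (z 1) ≤ orderDensity g z ∧
        orderDensity g z ≤ M * density (z 0) (z 1) := by
  obtain ⟨m, M, hm, hM, h⟩ := exists_hermLift_bounds g
  have hpi : 0 < Real.pi⁻¹ := inv_pos.2 Real.pi_pos
  refine ⟨Real.pi⁻¹ * m, Real.pi⁻¹ * M, by positivity, by positivity, fun z ↦ ?_⟩
  rw [orderDensity_eq, density_coord_eq, mul_assoc, mul_assoc]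
  have h0 := h _ (hopfCurve_ne_zero z) (fderiv ℂ hopfCurve z (EuclideanSpace.single 0 1))
  have h1 := h _ (hopfCurve_ne_zero z) (fderiv ℂ hopfCurve z (EuclideanSpace.single 1 1))
  constructor
  · refine mul_le_mul_of_nonneg_left ?_ hpi.le
    linarith [h0.1, h1.1]
  · refine mul_le_mul_of_nonneg_left ?_ hpi.le
    linarith [h0.2, h1.2]

lemma mapOrder_hopfMap (g : HermitianMetric (HopfSurface l)) : mapOrder g (hopfMap l) = 1 := by
  obtain ⟨m, M, hm, hM, hW⟩ := exists_orderDensity_bounds g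
  obtain ⟨C, hC, hupp⟩ := exists_energy_le
  obtain ⟨c, t₀, hc, ht₀, hlow⟩ := exists_le_energy
  have hWnn : ∀ z, 0 ≤ orderDensity g z := fun z ↦
    (mul_nonneg hm.le (density_nonneg _ _)).trans (hW z).1
  have hWint : ∀ t, IntegrableOn (orderDensity g) (Metric.ball 0 t) :=
    integrableOn_ball_of_continuous (continuous_orderDensity g)
  have hDint := integrableOn_ball_of_continuous continuous_density_coord
  have hlow' : ∀ t, m * energy t ≤ ∫ z in Metric.ball (0 : C2) t, orderDensity g z := fun t ↦ by
    rw [energy, ← integral_const_mul]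
    exact integral_mono ((hDint t).const_mul m) (hWint t) fun z ↦ (hW z).1
  have hupp' : ∀ t, ∫ z in Metric.ball (0 : C2) t, orderDensity g z ≤ M * energy t := fun t ↦ by
    rw [energy, ← integral_const_mul]
    exact integral_mono (hWint t) ((hDint t).const_mul M) fun z ↦ (hW z).2
  have hmono : Monotone fun t ↦ ∫ z in Metric.ball (0 : C2) t, orderDensity g z :=
    fun s t hst ↦ setIntegral_mono_set (hWint t) (Eventually.of_forall hWnn)
      (Metric.ball_subset_ball hst).eventuallyLE
  have key := tendsto_log_integral_div_log hmono (c := m * c) (C := M * C) (by positivity)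
    (by positivity) ht₀ (fun t ↦ integral_nonneg hWnn)
    (fun t ht ↦ (by
      rw [mul_assoc]
      exact (mul_le_mul_of_nonneg_left (hlow t ht) hm.le).trans (hlow' t)))
    (fun t ht ↦ (by
      rw [mul_assoc, mul_assoc, ← mul_assoc C]
      exact (hupp' t).trans (mul_le_mul_of_nonneg_left (hupp t ht) hM.le)))
  have key' : Tendsto (fun r : ℝ ↦ ((Real.log (orderFunction g (hopfMap l) r) / Real.log r : ℝ) :
      EReal)) atTop (𝓝 ((1 : ℝ) : EReal)) := (continuous_coe_real_ereal.tendsto 1).comp key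
  exact key'.limsup_eq

end Order

end

theorem mainTheorem3 (l : HopfMultiplier) :
    CompactSpace (HopfSurface l) ∧ ConnectedSpace (HopfSurface l) ∧ T2Space (HopfSurface l) ∧
    ¬ IsKahler (HopfSurface l) ∧
    Nonempty (HermitianMetric (HopfSurface l)) ∧
    ∃ f : C2 → HopfSurface l,
      ContMDiff 𝓘(ℂ, C2) 𝓘(ℂ, C2) ω f ∧
      IsDifferentiablyNondegenerate f ∧
      ∀ g : HermitianMetric (HopfSurface l), mapOrder g f = 1 :=
  ⟨compactSpace_hopfSurface l, connectedSpace_hopfSurface l, t2Space_hopfSurface l,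
    not_isKahler_hopfSurface l, ⟨stdHermitianMetric l⟩, hopfMap l, contMDiff_hopfMap l,
    isDifferentiablyNondegenerate_hopfMap l, mapOrder_hopfMap⟩
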